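/- Consider incremental (insertion-only) sequences $\mathcal G=(G_1,\dots,G_T)$ of finite simple undirected graphs with edge weights in $\{1,\dots,W\}$, $W\ge 1$: starting from an initial graph $G_0=(V_0,E_0)$, which may be non-empty, the graph $G_t=(V_t,E_t)$ arises from $G_{t-1}$ by inserting a set of nodes and a set of edges with endpoints in $V_t$. Weights of edges do not change over time. Let $w_{\mathrm{MST}}(G)$ be the weight of a minimum spanning tree of $G$ (of a minimum spanning forest, if $G$ is disconnected), and let $\Delta w_{\mathrm{MST}}(t)=w_{\mathrm{MST}}(G_t)-w_{\mathrm{MST}}(G_{t-1})$ for $1\le t\le T$. Two incremental sequences of the same length are edge-adjacent if they have the same initial graph, the same insertions and the same weights of common edges, except that at exactly one time step one of them inserts exactly one additional edge. A randomized algorithm releases a real number at each time step $t=1,\dots,T$, where its outputs up to time $t$ depend only on $G_0,\dots,G_t$; the length $T$ is known in advance. It is $\varepsilon$-edge-differentially private if for all edge-adjacent $\mathcal G,\mathcal G'$ and all measurable $O\subseteq\mathbb R^T$, the vectors of all outputs satisfy $\Pr[\mathcal A(\mathcal G)\in O]\le e^{\varepsilon}\Pr[\mathcal A(\mathcal G')\in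 O]$. (1) There is an absolute constant $C>0$ such that for all $W\ge 1$, $T\ge 2$ and $\varepsilon>0$ there is an $\varepsilon$-edge-differentially private algorithm $\mathcal A$ on incremental sequences of length $T$ with edge weights in $\{1,\dots,W\}$ such that, for every such sequence, every time step $t\in\{1,\dots,T\}$ and every $\delta\in(0,1)$, with probability at least $1-\delta$ the output at time $t$ differs from $w_{\mathrm{MST}}(G_t)$ by at most $C\,W\,\varepsilon^{-1}\,\log^{3/2}T\,\log\delta^{-1}$. (2) Let $W\ge 1$, and let nodes be taken from an infinite set. For all $T$ and all edge-adjacent incremental sequences $\mathcal G,\mathcal G'$ of length $T$ with edge weights in $\{1,\dots,W\}$ in which all graphs $G_1,\dots,G_T,G_1',\dots,G_T'$ are connected, $$\sum_{t=1}^T\bigl|\Delta w_{\mathrm{MST},\mathcal G}(t)-\Delta w_{\mathrm{MST},\mathcal G'}(t)\bigr|\le 2W-2,$$ and for every $T\ge 2$ equality is attained by some such pair; that is, the continuous global sensitivity of the difference sequence of the minimum spanning tree weight under edge-adjacency is $2W-2$. -/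

import Mathlib

open MeasureTheory

universe u

/-- The data of an insertion-only sequence of edge-weighted graphs `G_0, G_1, …, G_T` with nodes
from `V`: the initial node and edge sets, the node and edge sets inserted at each of the `T` time
steps (the entry `i : Fin T` is the update at time `i + 1`), and the edge weights. Only the weights
of edges that occur in the sequence have a meaning. -/
structure InsertionData (V : Type u) (T : ℕ) where
  initVerts : Finset V
  initEdges : Finset (Sym2 V)
  insVerts : Fin T → Finset V
  insEdges : Fin T → Finset (Sym2 V)
  weight : Sym2 V → ℕ

namespace InsertionData

variable {V : Type u} [DecidableEq V] {T : ℕ}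

/-- The node set `V_t` of `G_t`. -/
def verts (S : InsertionData V T) (t : ℕ) : Finset V :=
  S.initVerts ∪ (Finset.univ.filter fun i : Fin T => i.val < t).biUnion S.insVerts

/-- The edge set `E_t` of `G_t`. -/
def edges (S : InsertionData V T) (t : ℕ) : Finset (Sym2 V) :=
  S.initEdges ∪ (Finset.univ.filter fun i : Fin T => i.val < t).biUnion S.insEdges

end InsertionData

/-- `F` is a spanning forest of the graph with edge set `E`: a cycle-free set of edges of that
graph with the same connected components. If the graph is connected, this is a spanning tree. -/
def IsSpanningForest {V : Type u} (E F : Finset (Sym2 V)) : Prop :=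
  F ⊆ E ∧ (SimpleGraph.fromEdgeSet (F : Set (Sym2 V))).IsAcyclic ∧
    ∀ u v : V, (SimpleGraph.fromEdgeSet (E : Set (Sym2 V))).Reachable u v →
      (SimpleGraph.fromEdgeSet (F : Set (Sym2 V))).Reachable u v

/-- The minimum total weight of a spanning forest; for a connected graph, the weight of a minimum
spanning tree. -/
noncomputable def mstWeight {V : Type u} (E : Finset (Sym2 V)) (w : Sym2 V → ℕ) : ℕ :=
  sInf {x : ℕ | ∃ F : Finset (Sym2 V), IsSpanningForest E F ∧ ∑ e ∈ F, w e = x}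

/-- An incremental sequence of simple graphs of length `T` with edge weights in `{1, …, W}`. -/
structure IncrementalSeq (V : Type u) [DecidableEq V] (W T : ℕ) extends InsertionData V T where
  endpoint_mem : ∀ t ≤ T, ∀ e ∈ toInsertionData.edges t, ∀ v ∈ e, v ∈ toInsertionData.verts t
  loopless : ∀ e ∈ toInsertionData.edges T, ¬ e.IsDiag
  weight_mem : ∀ e ∈ toInsertionData.edges T, weight e ∈ Finset.Icc 1 W

namespace IncrementalSeq

variable {V : Type u} [DecidableEq V] {W T : ℕ}

/-- The minimum spanning tree weight of `G_t`. -/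
noncomputable def mst (S : IncrementalSeq V W T) (t : ℕ) : ℕ :=
  mstWeight (S.edges t) S.weight

/-- The difference sequence of the minimum spanning tree weight; the entry `i` is the one of
time `i + 1`. -/
noncomputable def diffMst (S : IncrementalSeq V W T) (i : Fin T) : ℝ :=
  (S.mst (i.val + 1) : ℝ) - (S.mst i.val : ℝ)

/-- Any two nodes of `G_t` are joined by a path, for each of the graphs `G_1, …, G_T`. -/
def AllConnected (S : IncrementalSeq V W T) : Prop :=
  ∀ t : ℕ, 1 ≤ t → t ≤ T → ∀ u ∈ S.verts t, ∀ v ∈ S.verts t,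
    (SimpleGraph.fromEdgeSet (S.edges t : Set (Sym2 V))).Reachable u v

/-- Edge-adjacency of incremental sequences (on event level): `S` and `S'` are equal, except that
at one time step `S` inserts one edge more than `S'`. -/
def EdgeAdj (S S' : IncrementalSeq V W T) : Prop :=
  S.initVerts = S'.initVerts ∧ S.initEdges = S'.initEdges ∧ S.insVerts = S'.insVerts ∧
    (∃ (e : Sym2 V) (i : Fin T), S'.insEdges i ⊆ S.insEdges i ∧
      S.insEdges i \ S'.insEdges i = {e} ∧ ∀ j ≠ i, S.insEdges j = S'.insEdges j) ∧
    ∀ e ∈ S'.edges T, S.weight e = S'.weight e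

/-- `S` and `S'` have the same initial graph and the same updates up to time `t`. -/
def AgreeUpTo (t : ℕ) (S S' : IncrementalSeq V W T) : Prop :=
  S.initVerts = S'.initVerts ∧ S.initEdges = S'.initEdges ∧
    (∀ i : Fin T, i.val < t → S.insVerts i = S'.insVerts i ∧ S.insEdges i = S'.insEdges i) ∧
    ∀ e ∈ S.edges t, S.weight e = S'.weight e

end IncrementalSeq

/-- A randomized algorithm that receives an incremental sequence and releases a real number at each
of the time steps `1, …, T`, given by the joint law of its outputs. The outputs up to time `t` do
not depend on updates after time `t`. -/
structure ContinualMechanism (V : Type u) [DecidableEq V] (W T : ℕ) where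
  law : IncrementalSeq V W T → Measure (Fin T → ℝ)
  isProbabilityMeasure : ∀ S, IsProbabilityMeasure (law S)
  causal : ∀ (t : ℕ) (S S' : IncrementalSeq V W T), S.AgreeUpTo t S' →
    (law S).map (fun (x : Fin T → ℝ) (i : {i : Fin T // i.val < t}) => x i) =
      (law S').map (fun (x : Fin T → ℝ) (i : {i : Fin T // i.val < t}) => x i)

/-- `ε`-edge-differential privacy. -/
def ContinualMechanism.EdgeDP {V : Type u} [DecidableEq V] {W T : ℕ}
    (A : ContinualMechanism V W T) (ε : ℝ) : Prop :=
  ∀ S S' : IncrementalSeq V W T, S.EdgeAdj S' ∨ S'.EdgeAdj S →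
    ∀ O : Set (Fin T → ℝ), MeasurableSet O →
      A.law S O ≤ ENNReal.ofReal (Real.exp ε) * A.law S' O

/-- The values `∑_{t=1}^T |Δf_S(t) - Δf_{S'}(t)|`, for `f` the minimum spanning tree weight, over
all edge-adjacent incremental sequences `S`, `S'` of connected graphs; the continuous global
sensitivity of `Δf` is the maximum of this set. -/
def diffMstDistances (V : Type u) [DecidableEq V] (W T : ℕ) : Set ℝ :=
  {x | ∃ S S' : IncrementalSeq V W T, S.AllConnected ∧ S'.AllConnected ∧ S.EdgeAdj S' ∧
    ∑ i : Fin T, |S.diffMst i - S'.diffMst i| = x}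

/-!
By Kruskal's algorithm, a minimum spanning forest with weights at most `W` satisfies
`w_MST(E) = W * r(E) - ∑ k < W, r(E_k)`, where `E_k` is the set of edges of weight at most `k` and
`r` is the rank function of the cycle matroid, here represented by vectors over `𝔽₂`. So an
additional edge `e` changes `w_MST(E)` by `W * ρ(E) - ∑ k ∈ [w(e), W), ρ(E_k)`, where
`ρ(E) ∈ {0, 1}` is the increase of the rank upon insertion of `e`. Both terms are antitone in `E`
and hence decrease with time once `e` is present; jumping from zero to at most `W` and at most
`W - 1`, they have variation at most `2W` and `2W - 2`. If the graphs are connected, the first term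
vanishes, and the bound `2W - 2` is attained by an edge that replaces an edge of weight `W` and
becomes superfluous one step later.

Since the difference of the weights of adjacent sequences has variation at most `4W` along every
level of a dyadic tree over the time steps, adding Laplace noise of scale `O(W log T / ε)` to all
dyadic increments is private, and every prefix sum involves only `O(log T)` of them.
-/

section MinimumWeightBasis

variable (K : Type*) {M ι : Type*} [DivisionRing K] [AddCommGroup M] [Module K M] (v : ι → M)

/-- The rank of the subfamily `E` of a family `v` of vectors, i.e. the rank function of the matroid
represented by `v`. -/
noncomputable def familyRank (E : Finset ι) : ℕ :=
  Module.finrank K (Submodule.span K (v '' E))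

open Classical in
/-- The increase of the rank of the subfamily `E` upon insertion of `x`. -/
noncomputable def rankGain (E : Finset ι) (x : ι) : ℕ :=
  if v x ∈ Submodule.span K (v '' E) then 0 else 1

variable {K v}

theorem finiteDimensional_span_image (E : Finset ι) :
    FiniteDimensional K (Submodule.span K (v '' E)) :=
  FiniteDimensional.span_of_finite K (E.finite_toSet.image v)

theorem familyRank_mono {E F : Finset ι} (h : E ⊆ F) : familyRank K v E ≤ familyRank K v F :=
  have := finiteDimensional_span_image (K := K) (v := v) F
  Submodule.finrank_mono (Submodule.span_mono (Set.image_mono (Finset.coe_subset.2 h)))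

theorem familyRank_eq_card {F : Finset ι} (hF : LinearIndepOn K v (F : Set ι)) :
    familyRank K v F = F.card := by
  rw [familyRank, Set.image_eq_range, ← Fintype.card_coe]
  exact finrank_span_eq_card (R := K) hF

theorem familyRank_insert [DecidableEq ι] (E : Finset ι) (x : ι) :
    familyRank K v (insert x E) = familyRank K v E + rankGain K v E x := by
  have := finiteDimensional_span_image (K := K) (v := v) E
  rw [familyRank, familyRank, rankGain, Finset.coe_insert, Set.image_insert_eq]
  split_ifs with hx
  · rw [Submodule.span_insert_eq_span hx, add_zero]
  · have hne : v x ≠ 0 := fun h => hx (h ▸ Submodule.zero_mem _)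
    have hdisj := (Submodule.disjoint_span_singleton' hne).2 hx
    have hdim := Submodule.finrank_sup_add_finrank_inf_eq (Submodule.span K (v '' E)) (K ∙ v x)
    rwa [hdisj.eq_bot, finrank_bot, add_zero, finrank_span_singleton hne, sup_comm,
      ← Submodule.span_insert] at hdim

theorem rankGain_le_one (E : Finset ι) (x : ι) : rankGain K v E x ≤ 1 := by
  unfold rankGain
  split_ifs <;> simp

theorem rankGain_anti {E F : Finset ι} (h : E ⊆ F) (x : ι) :
    rankGain K v F x ≤ rankGain K v E x := by
  have hspan : Submodule.span K (v '' E) ≤ Submodule.span K (v '' F) :=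
    Submodule.span_mono (Set.image_mono (Finset.coe_subset.2 h))
  unfold rankGain
  split_ifs with hF hE hE
  exacts [le_rfl, zero_le_one, absurd (hspan hE) hF, le_rfl]

-- Kruskal's algorithm: elements are examined in order of increasing weight.
theorem exists_greedy_basis {β : Type*} [LinearOrder β] (w : ι → β) (E : Finset ι) :
    ∃ F ⊆ E, LinearIndepOn K v (F : Set ι) ∧ ∀ k,
      Submodule.span K (v '' ({x ∈ F | w x ≤ k} : Finset ι)) =
        Submodule.span K (v '' ({x ∈ E | w x ≤ k} : Finset ι)) := by
  classical
  induction E using Finset.induction_on_max_value w with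
  | empty => exact ⟨∅, subset_rfl, by simp, fun k => rfl⟩
  | insert x E hxE hmax ih =>
    obtain ⟨F, hFE, hF, hspan⟩ := ih
    by_cases hx : v x ∈ Submodule.span K (v '' E)
    · refine ⟨F, hFE.trans (Finset.subset_insert x E), hF, fun k => ?_⟩
      rw [hspan, Finset.filter_insert]
      split_ifs with hk
      · rw [Finset.filter_true_of_mem fun y hy => (hmax y hy).trans hk, Finset.coe_insert,
          Set.image_insert_eq, Submodule.span_insert_eq_span hx]
      · rfl
    · have hxF : v x ∉ Submodule.span K (v '' F) := fun h =>
        hx (Submodule.span_mono (Set.image_mono (Finset.coe_subset.2 hFE)) h)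
      refine ⟨insert x F, Finset.insert_subset_insert x hFE, ?_, fun k => ?_⟩
      · rw [Finset.coe_insert, linearIndepOn_insert (mt (@hFE x) hxE)]
        exact ⟨hF, hxF⟩
      · rw [Finset.filter_insert, Finset.filter_insert]
        split_ifs with hk
        · simp only [Finset.coe_insert, Set.image_insert_eq, Submodule.span_insert, hspan]
        · exact hspan k

theorem sum_add_sum_card_filter_le {F : Finset ι} {w : ι → ℕ} {W : ℕ} (hw : ∀ x ∈ F, w x ≤ W) :
    ∑ x ∈ F, w x + ∑ k ∈ Finset.range W, {x ∈ F | w x ≤ k}.card = W * F.card := by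
  have hcount : ∀ x ∈ F, {k ∈ Finset.range W | w x ≤ k}.card = W - w x := fun x _ => by
    rw [← Nat.card_Ico]
    congr 1
    ext k
    simp [and_comm]
  simp_rw [Finset.card_filter]
  rw [Finset.sum_comm]
  simp_rw [← Finset.card_filter]
  rw [Finset.sum_congr rfl hcount, ← Finset.sum_add_distrib,
    Finset.sum_congr rfl fun x hx => Nat.add_sub_of_le (hw x hx), Finset.sum_const, smul_eq_mul,
    mul_comm]

theorem mul_familyRank_le_sum_add {E F : Finset ι} {w : ι → ℕ} {W : ℕ} (hw : ∀ x ∈ E, w x ≤ W)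
    (hFE : F ⊆ E) (hF : LinearIndepOn K v (F : Set ι))
    (hspan : Submodule.span K (v '' F) = Submodule.span K (v '' E)) :
    W * familyRank K v E ≤
      ∑ x ∈ F, w x + ∑ k ∈ Finset.range W, familyRank K v {x ∈ E | w x ≤ k} := by
  have hcard : F.card = familyRank K v E := by
    rw [← familyRank_eq_card hF, familyRank, hspan, familyRank]
  rw [← hcard, ← sum_add_sum_card_filter_le fun x hx => hw x (hFE hx)]
  gcongr with k
  rw [← familyRank_eq_card (hF.mono (Finset.coe_subset.2 (Finset.filter_subset _ F)))]
  exact familyRank_mono (Finset.filter_subset_filter _ hFE)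

theorem exists_basis_sum_add_eq_mul_familyRank {E : Finset ι} {w : ι → ℕ} {W : ℕ}
    (hw : ∀ x ∈ E, w x ≤ W) :
    ∃ F ⊆ E, LinearIndepOn K v (F : Set ι) ∧
      Submodule.span K (v '' F) = Submodule.span K (v '' E) ∧
      ∑ x ∈ F, w x + ∑ k ∈ Finset.range W, familyRank K v {x ∈ E | w x ≤ k} =
        W * familyRank K v E := by
  obtain ⟨F, hFE, hF, hgreedy⟩ := exists_greedy_basis (K := K) (v := v) w E
  have hspan : Submodule.span K (v '' F) = Submodule.span K (v '' E) := by
    have h := hgreedy W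
    rwa [Finset.filter_true_of_mem hw, Finset.filter_true_of_mem fun x hx => hw x (hFE hx)] at h
  refine ⟨F, hFE, hF, hspan, ?_⟩
  have hrank : ∀ k, familyRank K v {x ∈ E | w x ≤ k} = {x ∈ F | w x ≤ k}.card := fun k => by
    rw [← familyRank_eq_card (hF.mono (Finset.coe_subset.2 (Finset.filter_subset _ F))),
      familyRank, familyRank, hgreedy]
  have hcard : familyRank K v E = F.card := by
    rw [← familyRank_eq_card hF, familyRank, familyRank, hspan]
  simp only [hrank, hcard]
  exact sum_add_sum_card_filter_le fun x hx => hw x (hFE hx)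

end MinimumWeightBasis

section CycleMatroid

variable {V : Type u}

/-- The vector `δ_u + δ_v` over `𝔽₂` of an edge `uv`; these vectors represent the cycle matroid. -/
noncomputable def edgeVec : Sym2 V → (V →₀ ZMod 2) :=
  Sym2.lift ⟨fun u v => Finsupp.single u 1 + Finsupp.single v 1, fun _ _ => add_comm _ _⟩

theorem edgeVec_mk (u v : V) : edgeVec s(u, v) = Finsupp.single u 1 + Finsupp.single v 1 := rfl

theorem edgeVec_diag (u : V) : edgeVec s(u, u) = 0 := by
  rw [edgeVec_mk, ← Finsupp.single_add, CharTwo.add_self_eq_zero, Finsupp.single_zero]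

theorem edgeVec_add_edgeVec (u v x : V) :
    edgeVec s(u, v) + edgeVec s(v, x) = edgeVec s(u, x) := by
  rw [edgeVec_mk, edgeVec_mk, add_assoc, ← add_assoc (Finsupp.single v 1), ← edgeVec_mk v v,
    edgeVec_diag, zero_add, edgeVec_mk]

theorem eq_of_edgeVec_mem_span {E : Set (Sym2 V)} {f : V → ZMod 2}
    (hf : ∀ x y, s(x, y) ∈ E → f x = f y) {u v : V}
    (huv : edgeVec s(u, v) ∈ Submodule.span (ZMod 2) (edgeVec '' E)) : f u = f v := by
  have hφ : ∀ x y, Finsupp.linearCombination (ZMod 2) f (edgeVec s(x, y)) = f x + f y := by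
    simp [edgeVec_mk]
  have hker : Submodule.span (ZMod 2) (edgeVec '' E) ≤
      LinearMap.ker (Finsupp.linearCombination (ZMod 2) f) := by
    rw [Submodule.span_le]
    rintro _ ⟨⟨x, y⟩, hxy, rfl⟩
    exact (hφ x y).trans (CharTwo.add_eq_zero.2 (hf x y hxy))
  exact CharTwo.add_eq_zero.1 ((hφ u v).symm.trans (hker huv))

theorem edgeVec_mem_span_iff_reachable {E : Set (Sym2 V)} {u v : V} :
    edgeVec s(u, v) ∈ Submodule.span (ZMod 2) (edgeVec '' E) ↔
      (SimpleGraph.fromEdgeSet E).Reachable u v := by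
  classical
  constructor
  · intro h
    have hconst : ∀ x y, s(x, y) ∈ E →
        (if (SimpleGraph.fromEdgeSet E).Reachable u x then 1 else 0 : ZMod 2) =
          if (SimpleGraph.fromEdgeSet E).Reachable u y then 1 else 0 := by
      intro x y hxy
      have hreach : (SimpleGraph.fromEdgeSet E).Reachable x y := by
        rcases eq_or_ne x y with rfl | hne
        · rfl
        · exact ((SimpleGraph.fromEdgeSet_adj E).2 ⟨hxy, hne⟩).reachable
      exact if_congr ⟨fun hx => hx.trans hreach, fun hy => hy.trans hreach.symm⟩ rfl rfl
    simpa using eq_of_edgeVec_mem_span hconst h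
  · rintro ⟨p⟩
    induction p with
    | nil => rw [edgeVec_diag]; exact Submodule.zero_mem _
    | cons hadj p ih =>
      rw [← edgeVec_add_edgeVec]
      exact Submodule.add_mem _ (Submodule.subset_span
        (Set.mem_image_of_mem edgeVec ((SimpleGraph.fromEdgeSet_adj E).1 hadj).1)) ih

theorem isAcyclic_fromEdgeSet_iff {F : Set (Sym2 V)} (hF : ∀ e ∈ F, ¬ e.IsDiag) :
    (SimpleGraph.fromEdgeSet F).IsAcyclic ↔ LinearIndepOn (ZMod 2) edgeVec F := by
  have hbridge : ∀ u v, (SimpleGraph.fromEdgeSet F).IsBridge s(u, v) ↔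
      edgeVec s(u, v) ∉ Submodule.span (ZMod 2) (edgeVec '' (F \ {s(u, v)})) := fun u v => by
    rw [SimpleGraph.isBridge_iff, edgeVec_mem_span_iff_reachable,
      SimpleGraph.deleteEdges_fromEdgeSet]
  rw [SimpleGraph.isAcyclic_iff_forall_adj_isBridge, linearIndepOn_iff_notMem_span]
  constructor
  · rintro h ⟨u, v⟩ huv
    exact (hbridge u v).1 (h ((SimpleGraph.fromEdgeSet_adj F).2 ⟨huv, hF _ huv⟩))
  · intro h u v hadj
    exact (hbridge u v).2 (h _ ((SimpleGraph.fromEdgeSet_adj F).1 hadj).1)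

theorem isSpanningForest_iff {E F : Finset (Sym2 V)} (hE : ∀ e ∈ E, ¬ e.IsDiag) :
    IsSpanningForest E F ↔ F ⊆ E ∧ LinearIndepOn (ZMod 2) edgeVec (F : Set (Sym2 V)) ∧
      Submodule.span (ZMod 2) (edgeVec '' (F : Set (Sym2 V))) =
        Submodule.span (ZMod 2) (edgeVec '' (E : Set (Sym2 V))) := by
  refine and_congr_right fun hFE => ?_
  rw [isAcyclic_fromEdgeSet_iff fun e he => hE e (hFE he)]
  refine and_congr_right fun _ => ?_
  simp_rw [← edgeVec_mem_span_iff_reachable]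
  refine ⟨fun h => le_antisymm (Submodule.span_mono (Set.image_mono (Finset.coe_subset.2 hFE)))
    (Submodule.span_le.2 ?_), fun h u v => h.symm.le (x := _)⟩
  rintro _ ⟨⟨u, v⟩, huv, rfl⟩
  exact h u v (Submodule.subset_span (Set.mem_image_of_mem edgeVec huv))

theorem rankGain_edgeVec_eq_zero_iff {E : Finset (Sym2 V)} {u v : V} :
    rankGain (ZMod 2) edgeVec E s(u, v) = 0 ↔
      (SimpleGraph.fromEdgeSet (E : Set (Sym2 V))).Reachable u v := by
  rw [← edgeVec_mem_span_iff_reachable, rankGain]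
  split_ifs <;> simpa

end CycleMatroid

section MinimumSpanningForest

variable {V : Type u} {E : Finset (Sym2 V)} {w : Sym2 V → ℕ} {W : ℕ}

theorem mstWeight_congr {w' : Sym2 V → ℕ} (h : ∀ e ∈ E, w e = w' e) :
    mstWeight E w = mstWeight E w' := by
  unfold mstWeight
  congr! 3 with x
  refine exists_congr fun F => and_congr_right fun hF => ?_
  rw [Finset.sum_congr rfl fun e he => h e (hF.1 he)]

theorem mstWeight_add_sum_familyRank (hE : ∀ e ∈ E, ¬ e.IsDiag) (hw : ∀ e ∈ E, w e ≤ W) :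
    mstWeight E w + ∑ k ∈ Finset.range W, familyRank (ZMod 2) edgeVec {e ∈ E | w e ≤ k} =
      W * familyRank (ZMod 2) edgeVec E := by
  obtain ⟨F, hFE, hF, hspan, hsum⟩ :=
    exists_basis_sum_add_eq_mul_familyRank (K := ZMod 2) (v := edgeVec) hw
  have hmin : IsLeast {x | ∃ F, IsSpanningForest E F ∧ ∑ e ∈ F, w e = x} (∑ e ∈ F, w e) := by
    refine ⟨⟨F, (isSpanningForest_iff hE).2 ⟨hFE, hF, hspan⟩, rfl⟩, ?_⟩
    rintro _ ⟨F', hF', rfl⟩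
    obtain ⟨hFE', hindep, hspan'⟩ := (isSpanningForest_iff hE).1 hF'
    exact Nat.le_of_add_le_add_right
      (hsum.le.trans (mul_familyRank_le_sum_add hw hFE' hindep hspan'))
  rw [mstWeight, hmin.csInf_eq, hsum]

/-- The number of levels `k ∈ [w e, W)` such that the edges of `E` of weight at most `k` do not join
the endpoints of `e`. If `E` joins them by edges of weight at most `W`, then this is the weight
saved by exchanging the heaviest edge of an optimal path for `e`. -/
noncomputable def exchangeGain (E : Finset (Sym2 V)) (w : Sym2 V → ℕ) (W : ℕ) (e : Sym2 V) : ℕ :=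
  ∑ k ∈ Finset.Ico (w e) W, rankGain (ZMod 2) edgeVec {f ∈ E | w f ≤ k} e

theorem mstWeight_insert_add_exchangeGain [DecidableEq V] {e : Sym2 V}
    (hE : ∀ f ∈ insert e E, ¬ f.IsDiag) (hw : ∀ f ∈ insert e E, w f ≤ W) :
    mstWeight (insert e E) w + exchangeGain E w W e =
      mstWeight E w + W * rankGain (ZMod 2) edgeVec E e := by
  have hlevel : ∀ k, familyRank (ZMod 2) edgeVec {f ∈ insert e E | w f ≤ k} =
      familyRank (ZMod 2) edgeVec {f ∈ E | w f ≤ k} +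
        if w e ≤ k then rankGain (ZMod 2) edgeVec {f ∈ E | w f ≤ k} e else 0 := fun k => by
    rw [Finset.filter_insert]
    split_ifs
    · rw [familyRank_insert]
    · rfl
  have hIco : exchangeGain E w W e = ∑ k ∈ Finset.range W,
      if w e ≤ k then rankGain (ZMod 2) edgeVec {f ∈ E | w f ≤ k} e else 0 := by
    rw [exchangeGain, ← Finset.sum_filter]
    refine Finset.sum_congr ?_ fun _ _ => rfl
    ext k
    simp [and_comm]
  have hold := mstWeight_add_sum_familyRank (fun f hf => hE f (Finset.mem_insert_of_mem hf))
    fun f hf => hw f (Finset.mem_insert_of_mem hf)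
  have hnew := mstWeight_add_sum_familyRank hE hw
  simp_rw [hlevel] at hnew
  rw [Finset.sum_add_distrib, ← hIco, familyRank_insert, mul_add] at hnew
  omega

theorem exchangeGain_anti {E' : Finset (Sym2 V)} (h : E ⊆ E') (e : Sym2 V) :
    exchangeGain E' w W e ≤ exchangeGain E w W e :=
  Finset.sum_le_sum fun _ _ => rankGain_anti (Finset.filter_subset_filter _ h) e

theorem exchangeGain_le (e : Sym2 V) : exchangeGain E w W e ≤ W - w e :=
  (Finset.sum_le_card_nsmul _ _ 1 fun _ _ => rankGain_le_one _ _).trans (by simp)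

end MinimumSpanningForest

section Variation

variable {α : Type*} [LinearOrder α]

theorem eVariationOn_neg {β : Type*} [SeminormedAddCommGroup β] (f : α → β) (s : Set α) :
    eVariationOn (-f) s = eVariationOn f s := by
  simp only [eVariationOn, Pi.neg_apply, edist_neg_neg]

theorem eVariationOn_sub_le {β : Type*} [SeminormedAddCommGroup β] (f g : α → β) (s : Set α) :
    eVariationOn (f - g) s ≤ eVariationOn f s + eVariationOn g s := by
  refine iSup_le fun p => ?_
  have hdist : ∀ i, edist ((f - g) (p.2.1 (i + 1))) ((f - g) (p.2.1 i)) ≤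
      edist (f (p.2.1 (i + 1))) (f (p.2.1 i)) + edist (g (p.2.1 (i + 1))) (g (p.2.1 i)) :=
    fun i => by
      simpa only [Pi.sub_apply, sub_eq_add_neg, edist_neg_neg] using
        edist_add_add_le (f (p.2.1 (i + 1))) (-g (p.2.1 (i + 1))) (f (p.2.1 i)) (-g (p.2.1 i))
  refine (Finset.sum_le_sum fun i _ => hdist i).trans ?_
  rw [Finset.sum_add_distrib]
  exact add_le_add (eVariationOn.sum_le p.2.2.1 p.2.2.2) (eVariationOn.sum_le p.2.2.1 p.2.2.2)

theorem eVariationOn_univ_le_ofReal_iff {f : α → ℝ} {M : ℝ} (hM : 0 ≤ M) :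
    eVariationOn f Set.univ ≤ ENNReal.ofReal M ↔ ∀ (N : ℕ) (τ : ℕ → α), Monotone τ →
      ∑ q ∈ Finset.range N, |f (τ (q + 1)) - f (τ q)| ≤ M := by
  have hsum : ∀ (N : ℕ) (τ : ℕ → α), ∑ q ∈ Finset.range N, edist (f (τ (q + 1))) (f (τ q)) =
      ENNReal.ofReal (∑ q ∈ Finset.range N, |f (τ (q + 1)) - f (τ q)|) := fun N τ => by
    rw [ENNReal.ofReal_sum_of_nonneg fun _ _ => abs_nonneg _]
    exact Finset.sum_congr rfl fun _ _ => by rw [edist_dist, Real.dist_eq]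
  refine ⟨fun h N τ hτ => ?_, fun h => iSup_le fun p => ?_⟩
  · rw [← ENNReal.ofReal_le_ofReal_iff hM, ← hsum]
    exact (eVariationOn.sum_le hτ fun _ => Set.mem_univ _).trans h
  · rw [hsum]
    exact ENNReal.ofReal_le_ofReal (h _ _ p.2.2.1)

theorem eVariationOn_indicator_Ioi_le {a : α} {g : α → ℝ} {M : ℝ}
    (hg : AntitoneOn g (Set.Ioi a)) (hnonneg : ∀ t, 0 ≤ g t) (hle : ∀ t, g t ≤ M) :
    eVariationOn ((Set.Ioi a).indicator g) Set.univ ≤ ENNReal.ofReal (2 * M) := by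
  have hM : 0 ≤ M := (hnonneg a).trans (hle a)
  rw [eVariationOn_univ_le_ofReal_iff (by positivity)]
  intro N τ hτ
  set h := (Set.Ioi a).indicator g
  have hzero : ∀ t ≤ a, h t = 0 := fun t ht => Set.indicator_of_notMem ht.not_gt g
  have heq : ∀ t, a < t → h t = g t := fun t ht => Set.indicator_of_mem ht g
  suffices ∑ q ∈ Finset.range N, |h (τ (q + 1)) - h (τ q)| ≤
      if a < τ N then 2 * M - g (τ N) else 0 by
    refine this.trans ?_
    split_ifs
    exacts [sub_le_self _ (hnonneg _), by positivity]
  induction N with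
  | zero =>
    rw [Finset.sum_range_zero]
    split_ifs
    exacts [by linarith [hle (τ 0)], le_rfl]
  | succ N ih =>
    have hstep : τ N ≤ τ (N + 1) := hτ N.le_succ
    rw [Finset.sum_range_succ]
    rcases lt_or_ge a (τ N) with hN | hN
    · have hN' := hN.trans_le hstep
      have hdec := hg hN hN' hstep
      rw [if_pos hN] at ih
      rw [if_pos hN', heq _ hN, heq _ hN', abs_of_nonpos (sub_nonpos.2 hdec)]
      linarith
    · rw [if_neg hN.not_gt] at ih
      rw [hzero _ hN, sub_zero]
      split_ifs with hN'
      · rw [heq _ hN', abs_of_nonneg (hnonneg _)]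
        linarith [hle (τ (N + 1))]
      · simpa [hzero _ (not_lt.1 hN')] using ih

end Variation

namespace InsertionData

variable {V : Type u} [DecidableEq V] {T : ℕ} (S : InsertionData V T)

theorem mem_edges {t : ℕ} {e : Sym2 V} :
    e ∈ S.edges t ↔ e ∈ S.initEdges ∨ ∃ i : Fin T, i.val < t ∧ e ∈ S.insEdges i := by
  simp [edges]

theorem edges_mono : Monotone S.edges := fun s t hst e => by
  rw [mem_edges, mem_edges]
  exact Or.imp_right fun ⟨i, hi, he⟩ => ⟨i, hi.trans_le hst, he⟩

theorem edges_subset_edges_length (t : ℕ) : S.edges t ⊆ S.edges T := fun e => by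
  rw [mem_edges, mem_edges]
  exact Or.imp_right fun ⟨i, _, he⟩ => ⟨i, i.isLt, he⟩

end InsertionData

namespace IncrementalSeq

variable {V : Type u} [DecidableEq V] {W T : ℕ}

/-- The sequence `S` arises from `S'` by inserting the edge `e` at time `i + 1` in addition. In
contrast to `EdgeAdj`, this is formulated in terms of the graphs, and `e` may occur in `S'`. -/
structure InsertsAlso (S S' : IncrementalSeq V W T) (e : Sym2 V) (i : Fin T) : Prop where
  verts_eq : S.verts = S'.verts
  edges_of_le : ∀ t ≤ i.val, S.edges t = S'.edges t
  edges_of_lt : ∀ t, i.val < t → S.edges t = insert e (S'.edges t)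
  weight_eq : ∀ f ∈ S'.edges T, S.weight f = S'.weight f

theorem EdgeAdj.insertsAlso {S S' : IncrementalSeq V W T} (h : S.EdgeAdj S') {e : Sym2 V}
    {i : Fin T} (he : S.insEdges i \ S'.insEdges i = {e}) : S.InsertsAlso S' e i := by
  obtain ⟨hinitVerts, hinitEdges, hinsVerts, ⟨e', i', hsub, -, hother⟩, hweight⟩ := h
  obtain rfl : i = i' := by
    by_contra hi
    simp [hother i hi] at he
  have hins : ∀ j f, f ∈ S.insEdges j ↔ (j = i ∧ f = e) ∨ f ∈ S'.insEdges j := by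
    intro j f
    rcases eq_or_ne j i with rfl | hj
    · rw [← Finset.sdiff_union_of_subset hsub, he]
      simp
    · simp [hother j hj, hj]
  refine ⟨?_, fun t ht => ?_, fun t ht => ?_, hweight⟩
  · funext t
    rw [InsertionData.verts, InsertionData.verts, hinitVerts, hinsVerts]
  · ext f
    rw [InsertionData.mem_edges, InsertionData.mem_edges, hinitEdges]
    refine or_congr_right (exists_congr fun j => and_congr_right fun hj => ?_)
    rw [hother j (Fin.ne_of_lt (hj.trans_le ht))]
  · ext f
    simp only [Finset.mem_insert, InsertionData.mem_edges, hinitEdges, hins]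
    grind

theorem EdgeAdj.exists_insertsAlso {S S' : IncrementalSeq V W T} (h : S.EdgeAdj S') :
    ∃ e i, S.InsertsAlso S' e i :=
  let ⟨_, _, _, ⟨e, i, _, he, _⟩, _⟩ := id h
  ⟨e, i, h.insertsAlso he⟩

namespace InsertsAlso

variable {S S' : IncrementalSeq V W T} {e : Sym2 V} {i : Fin T}

theorem mem_edges (h : S.InsertsAlso S' e i) {t : ℕ} (ht : i.val < t) : e ∈ S.edges t := by
  rw [h.edges_of_lt t ht]
  exact Finset.mem_insert_self _ _

theorem weight_mem_Icc (h : S.InsertsAlso S' e i) : S.weight e ∈ Finset.Icc 1 W :=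
  S.weight_mem e (h.mem_edges i.isLt)

theorem mst_right (h : S.InsertsAlso S' e i) (t : ℕ) :
    S'.mst t = mstWeight (S'.edges t) S.weight :=
  mstWeight_congr fun f hf => (h.weight_eq f (S'.edges_subset_edges_length t hf)).symm

theorem mst_add_exchangeGain (h : S.InsertsAlso S' e i) {t : ℕ} (ht : i.val < t) :
    S.mst t + exchangeGain (S'.edges t) S.weight W e =
      S'.mst t + W * rankGain (ZMod 2) edgeVec (S'.edges t) e := by
  have hsub : insert e (S'.edges t) ⊆ S.edges T :=
    h.edges_of_lt t ht ▸ S.edges_subset_edges_length t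
  rw [h.mst_right, mst, h.edges_of_lt t ht]
  exact mstWeight_insert_add_exchangeGain (fun f hf => S.loopless f (hsub hf))
    fun f hf => (Finset.mem_Icc.1 (S.weight_mem f (hsub hf))).2

theorem mst_sub_mst (h : S.InsertsAlso S' e i) :
    (fun t => (S.mst t : ℝ) - S'.mst t) =
      (Set.Ioi i.val).indicator (fun t => W * (rankGain (ZMod 2) edgeVec (S'.edges t) e : ℝ)) -
      (Set.Ioi i.val).indicator (fun t => (exchangeGain (S'.edges t) S.weight W e : ℝ)) := by
  funext t
  rw [Pi.sub_apply]
  by_cases ht : t ∈ Set.Ioi i.val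
  · rw [Set.indicator_of_mem ht, Set.indicator_of_mem ht, sub_eq_sub_iff_add_eq_add]
    have hadd := h.mst_add_exchangeGain ht
    exact_mod_cast hadd.trans (add_comm _ _)
  · rw [Set.indicator_of_notMem ht, Set.indicator_of_notMem ht, h.mst_right, mst,
      h.edges_of_le t (not_lt.1 ht), sub_self, sub_self]

theorem eVariationOn_exchangeGain_le (h : S.InsertsAlso S' e i) :
    eVariationOn ((Set.Ioi i.val).indicator fun t =>
      (exchangeGain (S'.edges t) S.weight W e : ℝ)) Set.univ ≤ ENNReal.ofReal (2 * W - 2) := by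
  obtain ⟨hpos, hW⟩ := Finset.mem_Icc.1 h.weight_mem_Icc
  have hle : ∀ t, (exchangeGain (S'.edges t) S.weight W e : ℝ) ≤ W - 1 := fun t => by
    have := exchangeGain_le (E := S'.edges t) (w := S.weight) (W := W) e
    rw [le_sub_iff_add_le]
    exact_mod_cast (by omega : exchangeGain (S'.edges t) S.weight W e + 1 ≤ W)
  refine (eVariationOn_indicator_Ioi_le (fun s _ t _ hst => ?_) (fun t => Nat.cast_nonneg _)
    hle).trans_eq (by ring_nf)
  exact_mod_cast exchangeGain_anti (S'.edges_mono hst) e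

theorem eVariationOn_rankGain_le (S' : IncrementalSeq V W T) (e : Sym2 V) (n : ℕ) :
    eVariationOn ((Set.Ioi n).indicator fun t =>
      W * (rankGain (ZMod 2) edgeVec (S'.edges t) e : ℝ)) Set.univ ≤ ENNReal.ofReal (2 * W) := by
  refine eVariationOn_indicator_Ioi_le (fun s _ t _ hst => ?_) (fun t => by positivity)
    fun t => ?_
  · gcongr
    exact rankGain_anti (S'.edges_mono hst) e
  · exact mul_le_of_le_one_right (Nat.cast_nonneg W) (by exact_mod_cast rankGain_le_one _ _)

theorem eVariationOn_mst_sub_le (h : S.InsertsAlso S' e i) :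
    eVariationOn (fun t => (S.mst t : ℝ) - S'.mst t) Set.univ ≤ ENNReal.ofReal (4 * W) := by
  rw [h.mst_sub_mst]
  calc _ ≤ ENNReal.ofReal (2 * W) + ENNReal.ofReal (2 * W - 2) :=
        (eVariationOn_sub_le _ _ _).trans
          (add_le_add (eVariationOn_rankGain_le S' e i) h.eVariationOn_exchangeGain_le)
    _ ≤ ENNReal.ofReal (2 * W) + ENNReal.ofReal (2 * W) := by gcongr; linarith
    _ = ENNReal.ofReal (4 * W) := by
        rw [← ENNReal.ofReal_add (by positivity) (by positivity)]
        ring_nf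

theorem rankGain_eq_zero_of_allConnected (h : S.InsertsAlso S' e i) (hS' : S'.AllConnected)
    {t : ℕ} (ht : i.val < t) : rankGain (ZMod 2) edgeVec (S'.edges t) e = 0 := by
  refine Nat.eq_zero_of_le_zero ((rankGain_anti (S'.edges_mono ht) e).trans_eq ?_)
  have hend : ∀ x ∈ e, x ∈ S'.verts (i.val + 1) := fun x hx =>
    h.verts_eq ▸ S.endpoint_mem _ i.isLt _ (h.mem_edges i.val.lt_succ_self) x hx
  clear h
  obtain ⟨u, v⟩ := e
  exact rankGain_edgeVec_eq_zero_iff.2 (hS' _ i.val.succ_pos i.isLt u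
    (hend u (Sym2.mem_mk_left u v)) v (hend v (Sym2.mem_mk_right u v)))

theorem mst_sub_mst_of_allConnected (h : S.InsertsAlso S' e i) (hS' : S'.AllConnected) :
    (fun t => (S.mst t : ℝ) - S'.mst t) =
      -(Set.Ioi i.val).indicator (fun t => (exchangeGain (S'.edges t) S.weight W e : ℝ)) := by
  have hzero : (Set.Ioi i.val).indicator
      (fun t => W * (rankGain (ZMod 2) edgeVec (S'.edges t) e : ℝ)) = 0 :=
    Set.indicator_eq_zero'.2 <| Set.disjoint_left.2 fun t hsupp ht =>
      hsupp (by simp [h.rankGain_eq_zero_of_allConnected hS' ht])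
  rw [h.mst_sub_mst, hzero, zero_sub]

theorem sum_abs_diffMst_sub_le (h : S.InsertsAlso S' e i) (hS' : S'.AllConnected) :
    ∑ j : Fin T, |S.diffMst j - S'.diffMst j| ≤ 2 * W - 2 := by
  have hW : (1 : ℝ) ≤ W := by
    have := Finset.mem_Icc.1 h.weight_mem_Icc
    exact_mod_cast this.1.trans this.2
  have hvar : eVariationOn (fun t => (S.mst t : ℝ) - S'.mst t) Set.univ ≤
      ENNReal.ofReal (2 * W - 2) := by
    rw [h.mst_sub_mst_of_allConnected hS', eVariationOn_neg]
    exact h.eVariationOn_exchangeGain_le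
  have hsum := (eVariationOn_univ_le_ofReal_iff (by linarith)).1 hvar T id monotone_id
  rw [Finset.sum_range] at hsum
  simpa only [diffMst, sub_sub_sub_comm, id] using hsum

end InsertsAlso

theorem two_mul_sub_two_mem_upperBounds (V : Type u) [DecidableEq V] (W T : ℕ) :
    2 * (W : ℝ) - 2 ∈ upperBounds (diffMstDistances V W T) := by
  rintro _ ⟨S, S', -, hS', hadj, rfl⟩
  obtain ⟨e, i, h⟩ := hadj.exists_insertsAlso
  exact h.sum_abs_diffMst_sub_le hS'

section TwoPaths

variable {V : Type u} [DecidableEq V] (g : Fin 4 ↪ V) (W T : ℕ) (B : Finset (Sym2 V))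

/-- The data of the sequence showing that the sensitivity bound is tight, on the nodes
`(u, v, x, y) = (g 0, g 1, g 2, g 3)`. The path `u x v` with a heavy edge `xv` is present from the
start, the path `u y v` of light edges is completed at time `2`, and at time `1` the edges in `B`
are inserted, where `B` is going to be `∅` or `{uv}`. -/
def twoPathsData : InsertionData V T where
  initVerts := Finset.univ.map g
  initEdges := {s(g 0, g 2), s(g 2, g 1), s(g 0, g 3)}
  insVerts _ := ∅
  insEdges j := if j.val = 0 then B else if j.val = 1 then {s(g 3, g 1)} else ∅
  weight f := if f = s(g 2, g 1) then W else 1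

variable {g W T B}

theorem verts_twoPathsData (t : ℕ) : (twoPathsData g W T B).verts t = Finset.univ.map g := by
  simp [InsertionData.verts, twoPathsData]

theorem mem_edges_twoPathsData {t : ℕ} {f : Sym2 V} (hf : f ∈ (twoPathsData g W T B).edges t) :
    f = s(g 0, g 2) ∨ f = s(g 2, g 1) ∨ f = s(g 0, g 3) ∨ f ∈ B ∨ (2 ≤ t ∧ f = s(g 3, g 1)) := by
  rw [InsertionData.mem_edges] at hf
  simp only [twoPathsData] at hf
  grind

variable (g T) in
/-- The sequence with data `twoPathsData`. -/
def twoPaths (hW : 1 ≤ W) (hB : B ⊆ {s(g 0, g 1)}) : IncrementalSeq V W T where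
  toInsertionData := twoPathsData g W T B
  endpoint_mem t _ f hf z hz := by
    rw [verts_twoPathsData]
    rcases mem_edges_twoPathsData hf with rfl | rfl | rfl | hf | ⟨-, rfl⟩
    case inr.inr.inr.inl => obtain rfl := Finset.mem_singleton.1 (hB hf); aesop
    all_goals aesop
  loopless f hf := by
    rcases mem_edges_twoPathsData hf with rfl | rfl | rfl | hf | ⟨-, rfl⟩
    case inr.inr.inr.inl => obtain rfl := Finset.mem_singleton.1 (hB hf); simp
    all_goals simp
  weight_mem f _ := by
    simp only [twoPathsData]
    split_ifs <;> simp [hW]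

variable {hW : 1 ≤ W} {hB : B ⊆ {s(g 0, g 1)}}

theorem initEdges_subset_edges_twoPaths (t : ℕ) :
    {s(g 0, g 2), s(g 2, g 1), s(g 0, g 3)} ⊆ (twoPaths g T hW hB).edges t :=
  Finset.subset_union_left

theorem allConnected_twoPaths : (twoPaths g T hW hB).AllConnected := by
  intro t _ _
  have hadj : ∀ a b, a ≠ b → s(g a, g b) ∈ (twoPaths g T hW hB).edges t →
      (SimpleGraph.fromEdgeSet ((twoPaths g T hW hB).edges t : Set (Sym2 V))).Reachable
        (g a) (g b) := fun a b hab hmem =>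
    ((SimpleGraph.fromEdgeSet_adj _).2 ⟨hmem, g.injective.ne hab⟩).reachable
  have hinit := initEdges_subset_edges_twoPaths (hW := hW) (hB := hB) (T := T) t
  have hux := hadj 0 2 (by decide) (hinit (by simp))
  have hxv := hadj 2 1 (by decide) (hinit (by simp))
  have huy := hadj 0 3 (by decide) (hinit (by simp))
  have hroot : ∀ a, (SimpleGraph.fromEdgeSet
      ((twoPaths g T hW hB).edges t : Set (Sym2 V))).Reachable (g 0) (g a) := by
    intro a
    fin_cases a
    exacts [SimpleGraph.Reachable.refl _, hux.trans hxv, hux, huy]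
  have hverts : (twoPaths g T hW hB).verts t = Finset.univ.map g := verts_twoPathsData t
  simp only [hverts, Finset.mem_map, Finset.mem_univ, true_and]
  rintro _ ⟨a, rfl⟩ _ ⟨b, rfl⟩
  exact (hroot a).symm.trans (hroot b)

theorem edgeAdj_twoPaths (hT : 2 ≤ T) :
    (twoPaths g T hW (Finset.Subset.refl {s(g 0, g 1)})).EdgeAdj
      (twoPaths g T hW (Finset.empty_subset {s(g 0, g 1)})) := by
  refine ⟨rfl, rfl, rfl, ⟨s(g 0, g 1), ⟨0, by omega⟩, Finset.empty_subset _, Finset.sdiff_empty,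
    fun j hj => ?_⟩, fun _ _ => rfl⟩
  have hj : j.val ≠ 0 := fun h => hj (Fin.ext h)
  simp [twoPaths, twoPathsData, hj]

theorem insertsAlso_twoPaths (hT : 2 ≤ T) :
    (twoPaths g T hW (Finset.Subset.refl {s(g 0, g 1)})).InsertsAlso
      (twoPaths g T hW (Finset.empty_subset {s(g 0, g 1)})) s(g 0, g 1) ⟨0, by omega⟩ :=
  (edgeAdj_twoPaths hT).insertsAlso Finset.sdiff_empty

theorem weight_twoPaths : (twoPaths g T hW hB).weight s(g 0, g 1) = 1 := by
  simp [twoPaths, twoPathsData]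

theorem not_reachable_twoPaths_one {k : ℕ} (hk : k < W) :
    ¬ (SimpleGraph.fromEdgeSet
      (Finset.filter (fun f => (twoPaths g T hW hB).weight f ≤ k)
        ((twoPaths g T hW (Finset.empty_subset {s(g 0, g 1)})).edges 1) : Set (Sym2 V))).Reachable
          (g 0) (g 1) := by
  rw [SimpleGraph.reachable_comm]
  rintro ⟨p⟩
  obtain ⟨z, hadj⟩ : ∃ z, (SimpleGraph.fromEdgeSet _).Adj (g 1) z :=
    ⟨_, p.adj_snd (p.not_nil_of_ne (g.injective.ne (by decide)))⟩
  obtain ⟨hmem, -⟩ := (SimpleGraph.fromEdgeSet_adj _).1 hadj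
  obtain ⟨hmem, hle⟩ := Finset.mem_filter.1 (Finset.mem_coe.1 hmem)
  rcases mem_edges_twoPathsData hmem with h | h | h | h | ⟨h, -⟩
  · simp at h
  · simp [h, twoPaths, twoPathsData, hk.not_ge] at hle
  · simp at h
  · exact Finset.notMem_empty _ h
  · omega

theorem exchangeGain_twoPaths_one :
    exchangeGain ((twoPaths g T hW (Finset.empty_subset {s(g 0, g 1)})).edges 1)
      (twoPaths g T hW hB).weight W s(g 0, g 1) = W - 1 := by
  have hone : ∀ k ∈ Finset.Ico 1 W, rankGain (ZMod 2) edgeVec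
      {f ∈ (twoPaths g T hW (Finset.empty_subset {s(g 0, g 1)})).edges 1 |
        (twoPaths g T hW hB).weight f ≤ k} s(g 0, g 1) = 1 := fun k hk =>
    le_antisymm (rankGain_le_one _ _) <| Nat.one_le_iff_ne_zero.2 fun h =>
      not_reachable_twoPaths_one (Finset.mem_Ico.1 hk).2 (rankGain_edgeVec_eq_zero_iff.1 h)
  rw [exchangeGain, weight_twoPaths, Finset.sum_congr rfl hone]
  simp

theorem exchangeGain_twoPaths_two (hT : 2 ≤ T) :
    exchangeGain ((twoPaths g T hW (Finset.empty_subset {s(g 0, g 1)})).edges 2)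
      (twoPaths g T hW hB).weight W s(g 0, g 1) = 0 := by
  rw [exchangeGain, weight_twoPaths]
  refine Finset.sum_eq_zero fun k hk => rankGain_edgeVec_eq_zero_iff.2 ?_
  have hlight : ∀ a b, a ≠ b → s(a, b) ≠ s(2, 1) →
      s(g a, g b) ∈ (twoPaths g T hW (Finset.empty_subset {s(g 0, g 1)})).edges 2 →
      (SimpleGraph.fromEdgeSet
        (Finset.filter (fun f => (twoPaths g T hW hB).weight f ≤ k)
          ((twoPaths g T hW (Finset.empty_subset {s(g 0, g 1)})).edges 2) : Set (Sym2 V))).Reachable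
            (g a) (g b) := by
    intro a b hab hne hmem
    refine ((SimpleGraph.fromEdgeSet_adj _).2 ⟨?_, g.injective.ne hab⟩).reachable
    rw [Finset.mem_coe, Finset.mem_filter]
    refine ⟨hmem, (if_neg fun h => hne ?_).trans_le (Finset.mem_Ico.1 hk).1⟩
    exact Sym2.map.injective g.injective (by simpa using h)
  refine (hlight 0 3 (by decide) (by decide) (initEdges_subset_edges_twoPaths 2 (by simp))).trans
    (hlight 3 1 (by decide) (by decide) ?_)
  exact (InsertionData.mem_edges _).2 (Or.inr ⟨⟨1, hT⟩, Nat.one_lt_two, by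
    simp [twoPaths, twoPathsData]⟩)

theorem two_mul_sub_two_mem_diffMstDistances (g : Fin 4 ↪ V) (hW : 1 ≤ W) (hT : 2 ≤ T) :
    2 * (W : ℝ) - 2 ∈ diffMstDistances V W T := by
  have hins := insertsAlso_twoPaths (g := g) (hW := hW) hT
  refine ⟨_, _, allConnected_twoPaths, allConnected_twoPaths, edgeAdj_twoPaths (g := g)
    (hW := hW) hT, le_antisymm (hins.sum_abs_diffMst_sub_le allConnected_twoPaths) ?_⟩
  have hdiff := congrFun (hins.mst_sub_mst_of_allConnected allConnected_twoPaths)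
  have hzero := hdiff 0
  have hone := hdiff 1
  have htwo := hdiff 2
  simp only [Pi.neg_apply, Set.indicator, Set.mem_Ioi, exchangeGain_twoPaths_one,
    exchangeGain_twoPaths_two hT, lt_irrefl, Nat.one_pos, Nat.two_pos, if_true, if_false,
    Nat.cast_sub hW, Nat.cast_one, Nat.cast_zero, neg_zero] at hzero hone htwo
  refine le_trans ?_ (Finset.sum_le_sum_of_subset_of_nonneg
    (Finset.subset_univ {⟨0, by omega⟩, ⟨1, hT⟩}) fun _ _ _ => abs_nonneg _)
  rw [Finset.sum_pair (by simp)]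
  simp only [diffMst, zero_add, Nat.reduceAdd, sub_sub_sub_comm, hzero, hone, htwo]
  have hW' : (1 : ℝ) ≤ W := by exact_mod_cast hW
  rw [abs_of_nonpos (by linarith), abs_of_nonneg (by linarith)]
  linarith

end TwoPaths

end IncrementalSeq

section ProductMeasure

theorem measure_pi_mono {ι : Type*} [Fintype ι] {α : ι → Type*} [∀ i, MeasurableSpace (α i)]
    {μ ν : ∀ i, Measure (α i)} (h : ∀ i, μ i ≤ ν i) : Measure.pi μ ≤ Measure.pi ν := by
  refine Measure.le_iff.2 fun s hs => ?_
  rw [Measure.pi, Measure.pi, toMeasure_apply _ _ hs, toMeasure_apply _ _ hs]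
  refine OuterMeasure.le_pi.2 (fun t _ => (OuterMeasure.pi_pi_le _ _).trans ?_) s
  exact Finset.prod_le_prod' fun i _ => h i (t i)

theorem measure_pi_smul {ι : Type*} [Fintype ι] {α : ι → Type*} [∀ i, MeasurableSpace (α i)]
    (c : ι → NNReal) (μ : ∀ i, Measure (α i)) [∀ i, SigmaFinite (μ i)] :
    Measure.pi (fun i => c i • μ i) = (∏ i, c i) • Measure.pi μ :=
  Measure.pi_eq fun s _ => by
    simp only [Measure.pi_pi, Measure.smul_apply, ENNReal.smul_def, smul_eq_mul,
      ENNReal.ofNNReal_finsetProd, Finset.prod_mul_distrib]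

theorem map_prod_apply_le_of_le_smul {α β γ : Type*} [MeasurableSpace α] [MeasurableSpace β]
    [MeasurableSpace γ] {μ₁ μ₂ : Measure α} {c : ENNReal} (h : μ₁ ≤ c • μ₂) (ν : Measure β)
    [SFinite ν] {Φ : α × β → γ} (hΦ : Measurable Φ) {s : Set γ} (hs : MeasurableSet s) :
    (μ₁.prod ν).map Φ s ≤ c * (μ₂.prod ν).map Φ s := by
  rw [Measure.map_apply hΦ hs, Measure.map_apply hΦ hs, Measure.prod_apply (hΦ hs),
    Measure.prod_apply (hΦ hs)]
  refine (lintegral_mono' h le_rfl).trans ?_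
  rw [lintegral_smul_measure, smul_eq_mul]

theorem mul_measure_le_prod_apply {α β : Type*} [MeasurableSpace α] [MeasurableSpace β]
    {μ : Measure α} {ν : Measure β} [SFinite ν] {s : Set α} {t : Set (α × β)} {c : ENNReal}
    (hs : MeasurableSet s) (ht : MeasurableSet t) (h : ∀ x ∈ s, c ≤ ν (Prod.mk x ⁻¹' t)) :
    c * μ s ≤ μ.prod ν t :=
  calc c * μ s = ∫⁻ _ in s, c ∂μ := (setLIntegral_const s c).symm
    _ ≤ ∫⁻ x in s, ν (Prod.mk x ⁻¹' t) ∂μ := setLIntegral_mono' hs h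
    _ ≤ ∫⁻ x, ν (Prod.mk x ⁻¹' t) ∂μ := setLIntegral_le_lintegral _ _
    _ = μ.prod ν t := (Measure.prod_apply ht).symm

end ProductMeasure

section Laplace

open ProbabilityTheory

/-- The density of the Laplace distribution of scale `b`. -/
noncomputable def laplacePDF (b z : ℝ) : ℝ := Real.exp (-|z| / b) / (2 * b)

/-- The Laplace distribution of scale `b`, the law of the noise of the tree mechanism. -/
noncomputable def laplace (b : ℝ) : Measure ℝ :=
  volume.withDensity fun z => ENNReal.ofReal (laplacePDF b z)

variable {b c : ℝ}

theorem continuous_laplacePDF (b : ℝ) : Continuous (laplacePDF b) := by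
  unfold laplacePDF
  fun_prop

theorem laplacePDF_nonneg (hb : 0 < b) (z : ℝ) : 0 ≤ laplacePDF b z := by
  unfold laplacePDF
  positivity

theorem laplacePDF_mul_exp_of_nonneg (b c : ℝ) {z : ℝ} (hz : 0 ≤ z) :
    laplacePDF b z * Real.exp (c * z) = (2 * b)⁻¹ * Real.exp ((c - b⁻¹) * z) := by
  rw [laplacePDF, abs_of_nonneg hz, div_mul_eq_mul_div, ← Real.exp_add, div_eq_inv_mul]
  ring_nf

theorem laplacePDF_mul_exp_of_nonpos (b c : ℝ) {z : ℝ} (hz : z ≤ 0) :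
    laplacePDF b z * Real.exp (c * z) = (2 * b)⁻¹ * Real.exp ((c + b⁻¹) * z) := by
  rw [laplacePDF, abs_of_nonpos hz, div_mul_eq_mul_div, ← Real.exp_add, div_eq_inv_mul]
  ring_nf

theorem integrableOn_laplacePDF_mul_exp_Ioi (hc : c < b⁻¹) :
    IntegrableOn (fun z => laplacePDF b z * Real.exp (c * z)) (Set.Ioi 0) :=
  (integrableOn_congr_fun (fun _ hz => laplacePDF_mul_exp_of_nonneg b c (le_of_lt hz))
    measurableSet_Ioi).2 ((integrableOn_exp_mul_Ioi (sub_neg.2 hc) 0).const_mul _)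

theorem integrableOn_laplacePDF_mul_exp_Iic (hc : -b⁻¹ < c) :
    IntegrableOn (fun z => laplacePDF b z * Real.exp (c * z)) (Set.Iic 0) :=
  (integrableOn_congr_fun (fun _ hz => laplacePDF_mul_exp_of_nonpos b c hz)
    measurableSet_Iic).2 ((integrableOn_exp_mul_Iic (neg_lt_iff_pos_add.1 hc) 0).const_mul _)

theorem integrable_laplacePDF_mul_exp (hc : |c| < b⁻¹) :
    Integrable fun z => laplacePDF b z * Real.exp (c * z) := by
  rw [← integrableOn_univ, ← Set.Iic_union_Ioi (a := (0 : ℝ))]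
  exact (integrableOn_laplacePDF_mul_exp_Iic (abs_lt.1 hc).1).union
    (integrableOn_laplacePDF_mul_exp_Ioi (abs_lt.1 hc).2)

theorem integral_laplacePDF_mul_exp (hb : 0 < b) (hc : |c| < b⁻¹) :
    ∫ z, laplacePDF b z * Real.exp (c * z) = (1 - (c * b) ^ 2)⁻¹ := by
  obtain ⟨hlow, hup⟩ := abs_lt.1 hc
  rw [← intervalIntegral.integral_Iic_add_Ioi (integrableOn_laplacePDF_mul_exp_Iic hlow)
      (integrableOn_laplacePDF_mul_exp_Ioi hup),
    setIntegral_congr_fun measurableSet_Iic fun z hz => laplacePDF_mul_exp_of_nonpos b c hz,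
    setIntegral_congr_fun measurableSet_Ioi fun z hz =>
      laplacePDF_mul_exp_of_nonneg b c (le_of_lt hz),
    integral_const_mul, integral_const_mul, integral_exp_mul_Iic (neg_lt_iff_pos_add.1 hlow),
    integral_exp_mul_Ioi (sub_neg.2 hup)]
  have hadd : c * b + 1 ≠ 0 := by
    have := mul_pos (neg_lt_iff_pos_add.1 hlow) hb
    rw [add_mul, inv_mul_cancel₀ hb.ne'] at this
    exact this.ne'
  have hsub : c * b - 1 ≠ 0 := by
    have := mul_neg_of_neg_of_pos (sub_neg.2 hup) hb
    rw [sub_mul, inv_mul_cancel₀ hb.ne'] at this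
    exact this.ne
  rw [show c + b⁻¹ = (c * b + 1) / b by field_simp, show c - b⁻¹ = (c * b - 1) / b by field_simp,
    show 1 - (c * b) ^ 2 = -((c * b + 1) * (c * b - 1)) by ring]
  simp only [mul_zero, Real.exp_zero]
  generalize c * b = x at hadd hsub ⊢
  field_simp
  ring

theorem integrable_laplace_iff (hb : 0 < b) {f : ℝ → ℝ} :
    Integrable f (laplace b) ↔ Integrable fun z => laplacePDF b z * f z := by
  rw [laplace, integrable_withDensity_iff_integrable_smul'
    (continuous_laplacePDF b).measurable.ennreal_ofReal (by simp)]
  simp [ENNReal.toReal_ofReal (laplacePDF_nonneg hb _)]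

theorem integral_laplace (hb : 0 < b) (f : ℝ → ℝ) :
    ∫ z, f z ∂laplace b = ∫ z, laplacePDF b z * f z := by
  rw [laplace, integral_withDensity_eq_integral_toReal_smul
    (continuous_laplacePDF b).measurable.ennreal_ofReal (by simp)]
  simp [ENNReal.toReal_ofReal (laplacePDF_nonneg hb _)]

theorem integrable_exp_mul_laplace (hb : 0 < b) (hc : |c| < b⁻¹) :
    Integrable (fun z => Real.exp (c * z)) (laplace b) :=
  (integrable_laplace_iff hb).2 (integrable_laplacePDF_mul_exp hc)

theorem mgf_laplace (hb : 0 < b) (hc : |c| < b⁻¹) :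
    mgf (fun z => z) (laplace b) c = (1 - (c * b) ^ 2)⁻¹ :=
  (integral_laplace hb _).trans (integral_laplacePDF_mul_exp hb hc)

theorem isProbabilityMeasure_laplace (hb : 0 < b) : IsProbabilityMeasure (laplace b) := by
  have hzero : |(0 : ℝ)| < b⁻¹ := by simpa using hb
  have hint := integrable_exp_mul_laplace hb hzero
  have hmgf := mgf_laplace hb hzero
  simp only [zero_mul, Real.exp_zero] at hint
  have := (integrable_const_iff_isFiniteMeasure one_ne_zero).1 hint
  rw [mgf_zero'] at hmgf
  exact (isProbabilityMeasure_iff_real).2 (by simpa using hmgf)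

theorem laplacePDF_sub_le (hb : 0 < b) (x y z : ℝ) :
    laplacePDF b (z - x) ≤ Real.exp (|x - y| / b) * laplacePDF b (z - y) := by
  unfold laplacePDF
  rw [← mul_div_assoc, ← Real.exp_add, ← add_div]
  gcongr
  have := abs_sub_le z x y
  linarith

theorem map_add_laplace (b x : ℝ) :
    (laplace b).map (x + ·) =
      volume.withDensity fun z => ENNReal.ofReal (laplacePDF b (z - x)) := by
  ext s hs
  have hadd : Measurable (x + · : ℝ → ℝ) := measurable_const_add x
  rw [Measure.map_apply hadd hs, laplace, withDensity_apply _ (hadd hs), withDensity_apply _ hs,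
    ← lintegral_indicator (hadd hs), ← lintegral_indicator hs]
  refine Eq.trans (lintegral_congr fun z => ?_) (lintegral_add_left_eq_self _ x)
  simp only [Set.indicator, add_sub_cancel_left]
  rfl

theorem map_add_laplace_le (hb : 0 < b) (x y : ℝ) :
    (laplace b).map (x + ·) ≤
      ENNReal.ofReal (Real.exp (|x - y| / b)) • (laplace b).map (y + ·) := by
  rw [map_add_laplace, map_add_laplace, ← withDensity_smul']
  · refine withDensity_mono (Filter.Eventually.of_forall fun z => ?_)
    rw [Pi.smul_apply, smul_eq_mul]
    exact (ENNReal.ofReal_le_ofReal (laplacePDF_sub_le hb x y z)).trans_eq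
      (ENNReal.ofReal_mul (Real.exp_nonneg _))
  · exact ENNReal.ofReal_ne_top

variable {ι : Type*} [Fintype ι]

theorem map_add_pi_laplace_le (hb : 0 < b) (x y : ι → ℝ) :
    (Measure.pi fun _ : ι => laplace b).map (x + ·) ≤
      ENNReal.ofReal (Real.exp ((∑ i, |x i - y i|) / b)) •
        (Measure.pi fun _ : ι => laplace b).map (y + ·) := by
  have := isProbabilityMeasure_laplace hb
  have hpi : ∀ x : ι → ℝ, (Measure.pi fun _ : ι => laplace b).map (x + ·) =
      Measure.pi fun i => (laplace b).map (x i + ·) := fun x =>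
    have := fun i => Measure.isProbabilityMeasure_map (μ := laplace b)
      (measurable_const_add (x i)).aemeasurable
    Measure.pi_map_pi fun i => (measurable_const_add (x i)).aemeasurable
  have := fun i => Measure.isProbabilityMeasure_map (μ := laplace b)
    (measurable_const_add (y i)).aemeasurable
  rw [hpi, hpi]
  refine (measure_pi_mono fun i => map_add_laplace_le hb (x i) (y i)).trans_eq ?_
  refine (measure_pi_smul (fun i => (Real.exp (|x i - y i| / b)).toNNReal) _).trans ?_
  rw [← Real.toNNReal_prod_of_nonneg fun _ _ => Real.exp_nonneg _,
    ← Real.exp_sum, ← Finset.sum_div]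
  rfl

theorem integrable_exp_mul_apply_pi_laplace (hb : 0 < b) (hc : |c| < b⁻¹) (i : ι) :
    Integrable (fun z : ι → ℝ => Real.exp (c * z i)) (Measure.pi fun _ => laplace b) :=
  have := isProbabilityMeasure_laplace hb
  (measurePreserving_eval (fun _ : ι => laplace b) i).integrable_comp_of_integrable
    (integrable_exp_mul_laplace hb hc)

theorem mgf_apply_pi_laplace (hb : 0 < b) (hc : |c| < b⁻¹) (i : ι) :
    mgf (fun z : ι → ℝ => z i) (Measure.pi fun _ => laplace b) c = (1 - (c * b) ^ 2)⁻¹ := by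
  have := isProbabilityMeasure_laplace hb
  have heval := measurePreserving_eval (fun _ : ι => laplace b) i
  have hmap := mgf_map (X := fun z => z) (t := c) heval.aemeasurable (by fun_prop)
  rw [heval.map_eq, mgf_laplace hb hc] at hmap
  exact hmap.symm

theorem iIndepFun_apply_pi_laplace (hb : 0 < b) :
    iIndepFun (fun (i : ι) (z : ι → ℝ) => z i) (Measure.pi fun _ => laplace b) :=
  have := isProbabilityMeasure_laplace hb
  iIndepFun_pi fun _ => aemeasurable_id

theorem inv_one_sub_pow_le {x : ℝ} {n : ℕ} (hx : x ≤ 1) (hn : n * x ≤ 1 / 4) :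
    (1 - x)⁻¹ ^ n ≤ 4 / 3 := by
  have hbernoulli := one_add_mul_le_pow (a := -x) (by linarith) n
  rw [← sub_eq_add_neg] at hbernoulli
  rw [inv_pow, inv_le_comm₀ (lt_of_lt_of_le (by linarith) hbernoulli) (by norm_num)]
  linarith

/-- The scale of the exponential tail of the sum of `n` independent Laplace variables of
scale `b`. -/
noncomputable def laplaceTailScale (b : ℝ) (n : ℕ) : ℝ := 2 * b * √n

theorem laplaceTailScale_pos (hb : 0 < b) {n : ℕ} (hn : n ≠ 0) : 0 < laplaceTailScale b n := by
  unfold laplaceTailScale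
  positivity

theorem natCast_mul_sq_inv_laplaceTailScale_mul (hb : 0 < b) {n : ℕ} (hn : n ≠ 0) :
    n * ((laplaceTailScale b n)⁻¹ * b) ^ 2 = 1 / 4 := by
  have hn' : (n : ℝ) ≠ 0 := Nat.cast_ne_zero.2 hn
  rw [mul_pow, laplaceTailScale, inv_pow, mul_pow, Real.sq_sqrt n.cast_nonneg]
  field_simp
  norm_num

theorem abs_lt_inv_of_natCast_mul_sq_eq (hb : 0 < b) {n : ℕ}
    (hc : n * (c * b) ^ 2 = 1 / 4) : |c| < b⁻¹ := by
  have hn : (1 : ℝ) ≤ n := by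
    rw [Nat.one_le_cast, Nat.one_le_iff_ne_zero]
    rintro rfl
    norm_num at hc
  have hsq : (c * b) ^ 2 < 1 := by nlinarith [sq_nonneg (c * b)]
  rwa [← one_div, lt_div_iff₀ hb, ← abs_of_pos hb, ← abs_mul, ← sq_lt_one_iff_abs_lt_one]

theorem mgf_sum_pi_laplace_le (hb : 0 < b) {A : Finset ι} (hc : A.card * (c * b) ^ 2 = 1 / 4) :
    mgf (∑ i ∈ A, fun z : ι → ℝ => z i) (Measure.pi fun _ => laplace b) c ≤ 4 / 3 := by
  have hlt := abs_lt_inv_of_natCast_mul_sq_eq hb hc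
  have hle : (c * b) ^ 2 ≤ 1 := by
    rw [sq_le_one_iff_abs_le_one, abs_mul, abs_of_pos hb, ← le_div_iff₀ hb, one_div]
    exact hlt.le
  rw [(iIndepFun_apply_pi_laplace hb).mgf_sum (fun i => measurable_pi_apply i),
    Finset.prod_congr rfl fun i _ => mgf_apply_pi_laplace hb hlt i, Finset.prod_const]
  exact inv_one_sub_pow_le hle hc.le

theorem pi_laplace_abs_sum_gt_le (hb : 0 < b) {A : Finset ι} (hA : A.Nonempty) (s : ℝ) :
    (Measure.pi fun _ : ι => laplace b).real {z | s < |∑ i ∈ A, z i|} ≤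
      3 * Real.exp (-s / laplaceTailScale b A.card) := by
  have := isProbabilityMeasure_laplace hb
  set σ := laplaceTailScale b A.card
  have hσpos : 0 < σ := laplaceTailScale_pos hb hA.card_ne_zero
  have hplus : A.card * (σ⁻¹ * b) ^ 2 = 1 / 4 :=
    natCast_mul_sq_inv_laplaceTailScale_mul hb hA.card_ne_zero
  have hminus : A.card * (-σ⁻¹ * b) ^ 2 = 1 / 4 := by rwa [neg_mul, neg_sq]
  have hint : ∀ c, A.card * (c * b) ^ 2 = 1 / 4 → Integrable
      (fun z : ι → ℝ => Real.exp (c * (∑ i ∈ A, fun z : ι → ℝ => z i) z))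
      (Measure.pi fun _ => laplace b) := fun c hc =>
    (iIndepFun_apply_pi_laplace hb).integrable_exp_mul_sum (fun i => measurable_pi_apply i)
      fun i _ => integrable_exp_mul_apply_pi_laplace hb (abs_lt_inv_of_natCast_mul_sq_eq hb hc) i
  have hupper := measure_ge_le_exp_mul_mgf s (inv_nonneg.2 hσpos.le) (hint _ hplus)
  have hlower := measure_le_le_exp_mul_mgf (-s) (neg_nonpos.2 (inv_nonneg.2 hσpos.le))
    (hint _ hminus)
  simp only [Finset.sum_apply, neg_neg, mul_neg] at hupper hlower
  have hsub : {z : ι → ℝ | s < |∑ i ∈ A, z i|} ⊆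
      {z | s ≤ ∑ i ∈ A, z i} ∪ {z | ∑ i ∈ A, z i ≤ -s} := fun z hz =>
    (lt_abs.1 hz).imp le_of_lt fun h =>
      (le_neg.2 h.le : ∑ i ∈ A, z i ≤ -s)
  calc _ ≤ _ := (measureReal_mono hsub).trans (measureReal_union_le _ _)
    _ ≤ Real.exp (-σ⁻¹ * s) * (4 / 3) + Real.exp (-(σ⁻¹ * s)) * (4 / 3) :=
        add_le_add (hupper.trans (by gcongr; exact mgf_sum_pi_laplace_le hb hplus))
          (hlower.trans (by gcongr; exact mgf_sum_pi_laplace_le hb hminus))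
    _ = 8 / 3 * Real.exp (-s / σ) := by ring_nf
    _ ≤ 3 * Real.exp (-s / σ) := by gcongr; norm_num

end Laplace

section UniformShift

/-- The uniform distribution on `[-K, K]`. -/
noncomputable def uniformSym (K : ℝ) : Measure ℝ :=
  ProbabilityTheory.cond volume (Set.Icc (-K) K)

variable {K : ℝ}

theorem volume_Icc_neg_ne_zero (hK : 0 < K) : volume (Set.Icc (-K) K) ≠ 0 := by
  rw [Real.volume_Icc, ne_eq, ENNReal.ofReal_eq_zero]
  linarith

theorem isProbabilityMeasure_uniformSym (hK : 0 < K) : IsProbabilityMeasure (uniformSym K) :=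
  ProbabilityTheory.cond_isProbabilityMeasure_of_finite (volume_Icc_neg_ne_zero hK)
    measure_Icc_lt_top.ne

theorem uniformSym_Icc (hK : 0 < K) : uniformSym K (Set.Icc (-K) K) = 1 :=
  ProbabilityTheory.cond_apply_self (volume_Icc_neg_ne_zero hK) measure_Icc_lt_top.ne

theorem le_uniformSym_abs_add_le {x s : ℝ} (hK : 0 < K) (hx : |x| + s ≤ K) :
    ENNReal.ofReal (s / K) ≤ uniformSym K {u | |x + u| ≤ s} := by
  have hsub : Set.Icc (-x - s) (-x + s) ⊆ Set.Icc (-K) K ∩ {u | |x + u| ≤ s} := by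
    rintro u ⟨hlow, hup⟩
    have hlow' := neg_abs_le x
    have hup' := le_abs_self x
    have habs : |x + u| ≤ s := abs_le.2 ⟨by linarith, by linarith⟩
    exact ⟨⟨by linarith, by linarith⟩, habs⟩
  calc ENNReal.ofReal (s / K) = (volume (Set.Icc (-K) K))⁻¹ *
        volume (Set.Icc (-x - s) (-x + s)) := by
        rw [Real.volume_Icc, Real.volume_Icc, ← ENNReal.ofReal_inv_of_pos (by linarith),
          ← ENNReal.ofReal_mul (inv_nonneg.2 (by linarith))]
        congr 1
        field_simp
        ring
    _ ≤ (volume (Set.Icc (-K) K))⁻¹ * volume (Set.Icc (-K) K ∩ {u | |x + u| ≤ s}) := by gcongr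
    _ = uniformSym K {u | |x + u| ≤ s} :=
        (ProbabilityTheory.cond_apply measurableSet_Icc _ _).symm

variable {Ω : Type*} [MeasurableSpace Ω] {μ : Measure Ω} [IsProbabilityMeasure μ] {X : Ω → ℝ}
  {σ δ : ℝ}

theorem le_measure_abs_le_of_measure_lt_abs_le {s : ℝ} (hX : Measurable X)
    (h : μ.real {ω | s < |X ω|} ≤ δ) : ENNReal.ofReal (1 - δ) ≤ μ {ω | |X ω| ≤ s} := by
  have hcompl : {ω | |X ω| ≤ s} = {ω | s < |X ω|}ᶜ := by
    ext ω
    simp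
  rw [ENNReal.ofReal_le_iff_le_toReal (measure_ne_top _ _), ← Measure.real, hcompl,
    probReal_compl_eq_one_sub (measurableSet_lt measurable_const hX.abs)]
  linarith

theorem le_prod_uniformSym_abs_add_le_of_le (hX : Measurable X) (hσ : 0 < σ)
    (htail : ∀ s, μ.real {ω | s < |X ω|} ≤ 3 * Real.exp (-s / σ)) (hδ : 0 < δ) (hδ' : δ ≤ 3 / 4) :
    ENNReal.ofReal (1 - δ) ≤ (μ.prod (uniformSym (4 * σ)))
      {p | |X p.1 + p.2| ≤ 21 * σ * Real.log δ⁻¹} := by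
  set l := Real.log δ⁻¹ with hl
  have hquarter : 1 / 4 ≤ l := by
    have := Real.one_sub_inv_le_log_of_pos (inv_pos.2 hδ)
    rw [inv_inv] at this
    linarith
  have hbad : μ.real {ω | 5 * σ * l < |X ω|} ≤ δ := by
    have hexp : Real.exp (-(5 * σ * l) / σ) = δ ^ 5 := by
      rw [show -(5 * σ * l) / σ = (5 : ℕ) * Real.log δ by
        rw [hl, Real.log_inv]; push_cast; field_simp, ← Real.log_pow, Real.exp_log (by positivity)]
    calc _ ≤ 3 * δ ^ 4 * δ := (htail _).trans_eq (by rw [hexp]; ring)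
      _ ≤ 3 * (3 / 4) ^ 4 * δ := by gcongr
      _ ≤ δ := by linarith
  have hsub : {ω | |X ω| ≤ 5 * σ * l} ×ˢ Set.Icc (-(4 * σ)) (4 * σ) ⊆
      {p | |X p.1 + p.2| ≤ 21 * σ * l} := by
    rintro ⟨ω, u⟩ ⟨hω, hu⟩
    have hle : 4 * σ ≤ 16 * σ * l := by nlinarith
    calc |X ω + u| ≤ |X ω| + |u| := abs_add_le _ _
      _ ≤ 5 * σ * l + 16 * σ * l := add_le_add hω ((abs_le.2 hu).trans hle)
      _ = 21 * σ * l := by ring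
  calc ENNReal.ofReal (1 - δ) ≤ μ {ω | |X ω| ≤ 5 * σ * l} :=
        le_measure_abs_le_of_measure_lt_abs_le hX hbad
    _ = (μ.prod (uniformSym (4 * σ))) ({ω | |X ω| ≤ 5 * σ * l} ×ˢ Set.Icc (-(4 * σ)) (4 * σ)) := by
        have := isProbabilityMeasure_uniformSym (K := 4 * σ) (by linarith)
        rw [Measure.prod_prod, uniformSym_Icc (by linarith), mul_one]
    _ ≤ _ := measure_mono hsub

theorem le_prod_uniformSym_abs_add_le_of_ge (hX : Measurable X) (hσ : 0 < σ)
    (htail : ∀ s, μ.real {ω | s < |X ω|} ≤ 3 * Real.exp (-s / σ)) (hδ : 3 / 4 ≤ δ) (hδ' : δ ≤ 1) :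
    ENNReal.ofReal (1 - δ) ≤ (μ.prod (uniformSym (4 * σ)))
      {p | |X p.1 + p.2| ≤ 8 * σ * (1 - δ)} := by
  have := isProbabilityMeasure_uniformSym (K := 4 * σ) (by linarith)
  have hbad : μ.real {ω | 2 * σ < |X ω|} ≤ 1 / 2 := by
    have hexp : 6 ≤ Real.exp 2 := by
      rw [show (2 : ℝ) = 1 + 1 by norm_num, Real.exp_add]
      nlinarith [Real.exp_one_gt_d9]
    refine (htail _).trans ?_
    rw [show -(2 * σ) / σ = -2 by field_simp, Real.exp_neg, ← div_eq_mul_inv,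
      div_le_iff₀ (Real.exp_pos _)]
    linarith
  calc ENNReal.ofReal (1 - δ) =
        ENNReal.ofReal (8 * σ * (1 - δ) / (4 * σ)) * ENNReal.ofReal (1 - 1 / 2) := by
        have : 0 ≤ 1 - δ := by linarith
        rw [← ENNReal.ofReal_mul (by positivity)]
        congr 1
        field_simp
        ring
    _ ≤ ENNReal.ofReal (8 * σ * (1 - δ) / (4 * σ)) * μ {ω | |X ω| ≤ 2 * σ} := by
        gcongr
        exact le_measure_abs_le_of_measure_lt_abs_le hX hbad
    _ ≤ _ := by
        refine mul_measure_le_prod_apply (measurableSet_le hX.abs measurable_const)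
          (measurableSet_le (by fun_prop) measurable_const) fun ω hω => ?_
        have hsum : |X ω| + 8 * σ * (1 - δ) ≤ 4 * σ := by
          have : |X ω| ≤ 2 * σ := hω
          nlinarith
        exact le_uniformSym_abs_add_le (by linarith) hsum

theorem le_prod_uniformSym_abs_add_le (hX : Measurable X) (hσ : 0 < σ)
    (htail : ∀ s, μ.real {ω | s < |X ω|} ≤ 3 * Real.exp (-s / σ)) (hδ : 0 < δ) (hδ' : δ ≤ 1) :
    ENNReal.ofReal (1 - δ) ≤ (μ.prod (uniformSym (4 * σ)))
      {p | |X p.1 + p.2| ≤ 21 * σ * Real.log δ⁻¹} := by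
  rcases le_total δ (3 / 4) with hcase | hcase
  · exact le_prod_uniformSym_abs_add_le_of_le hX hσ htail hδ hcase
  have hlog := Real.one_sub_inv_le_log_of_pos (inv_pos.2 hδ)
  rw [inv_inv] at hlog
  have hle : 8 * σ * (1 - δ) ≤ 21 * σ * Real.log δ⁻¹ := by
    have : 0 ≤ 1 - δ := by linarith
    gcongr
    norm_num
  exact (le_prod_uniformSym_abs_add_le_of_ge hX hσ htail hcase hδ').trans
    (measure_mono fun p (hp : |X p.1 + p.2| ≤ _) => (hp.trans hle : |X p.1 + p.2| ≤ _))

end UniformShift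

section DyadicTree

variable {T : ℕ}

/-- The increment of `f` over the dyadic interval that ends at `q * 2 ^ l` and has length `2 ^ l`
if `q` is odd; zero if `q` is even. -/
def dyadicIncr (f : ℕ → ℝ) (l q : ℕ) : ℝ := f (q * 2 ^ l) - f (q / 2 * 2 ^ (l + 1))

theorem sum_dyadicIncr (f : ℕ → ℝ) {t L : ℕ} (ht : t < 2 ^ L) :
    ∑ l ∈ Finset.range L, dyadicIncr f l (t / 2 ^ l) = f t - f 0 := by
  simp_rw [dyadicIncr, Nat.div_div_eq_div_mul, ← pow_succ]
  rw [Finset.sum_range_sub' fun l => f (t / 2 ^ l * 2 ^ l)]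
  simp [Nat.div_eq_of_lt ht]

theorem abs_dyadicIncr_succ_le (f : ℕ → ℝ) (l q : ℕ) :
    |dyadicIncr f l (q + 1)| ≤ |f ((q + 1) * 2 ^ l) - f (q * 2 ^ l)| := by
  rw [dyadicIncr, pow_succ', ← mul_assoc]
  rcases Nat.even_or_odd' q with ⟨m, rfl | rfl⟩
  · rw [show (2 * m + 1) / 2 * 2 = 2 * m by omega]
  · rw [show (2 * m + 1 + 1) / 2 * 2 = 2 * m + 1 + 1 by omega, sub_self, abs_zero]
    exact abs_nonneg _

theorem sum_abs_dyadicIncr_le {f : ℕ → ℝ} {M : ℝ} (hM : 0 ≤ M)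
    (hf : eVariationOn f Set.univ ≤ ENNReal.ofReal M) (l N : ℕ) :
    ∑ q ∈ Finset.range (N + 1), |dyadicIncr f l q| ≤ M := by
  have hzero : dyadicIncr f l 0 = 0 := by simp [dyadicIncr]
  rw [Finset.sum_range_succ', hzero, abs_zero, add_zero]
  exact (Finset.sum_le_sum fun q _ => abs_dyadicIncr_succ_le f l q).trans
    ((eVariationOn_univ_le_ofReal_iff hM).1 hf N (· * 2 ^ l)
      fun _ _ h => Nat.mul_le_mul_right _ h)

/-- The number of levels of the dyadic tree over `T` time steps. -/
def treeDepth (T : ℕ) : ℕ := Nat.log 2 T + 1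

theorem treeDepth_pos (T : ℕ) : 0 < treeDepth T := Nat.succ_pos _

theorem treeDepth_le (hT : 2 ≤ T) : (treeDepth T : ℝ) ≤ 3 * Real.log T := by
  have hT' : (2 : ℝ) ≤ T := by exact_mod_cast hT
  have hlog : (Nat.log 2 T : ℝ) * Real.log 2 ≤ Real.log T := by
    rw [← Real.log_pow]
    refine Real.log_le_log (by positivity) ?_
    exact_mod_cast Nat.pow_log_le_self 2 (by omega)
  have hlog_two : Real.log 2 ≤ Real.log T := Real.log_le_log two_pos hT'
  rw [treeDepth]
  push_cast
  nlinarith [Real.log_two_gt_d9]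

theorem treeDepth_mul_sqrt_le (hT : 2 ≤ T) :
    treeDepth T * √(treeDepth T) ≤ 6 * Real.log T ^ (3 / 2 : ℝ) := by
  have hpos : 0 < Real.log T := Real.log_pos (by exact_mod_cast hT)
  have hsqrt : √(3 : ℝ) ≤ 2 := Real.sqrt_le_iff.2 ⟨by norm_num, by norm_num⟩
  calc treeDepth T * √(treeDepth T) ≤ 3 * Real.log T * √(3 * Real.log T) := by
        gcongr <;> exact treeDepth_le hT
    _ = √3 * (3 * (Real.log T * √(Real.log T))) := by
        rw [Real.sqrt_mul (by norm_num)]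
        ring
    _ ≤ 2 * (3 * (Real.log T * √(Real.log T))) := by gcongr
    _ = 6 * Real.log T ^ (3 / 2 : ℝ) := by
        rw [show (3 / 2 : ℝ) = 1 + 1 / 2 by norm_num, Real.rpow_add hpos, Real.rpow_one,
          Real.sqrt_eq_rpow]
        ring

/-- The nodes of the dyadic tree over `T` time steps. The node `(l, q)` stands for the dyadic
increment on level `l` that ends at `q * 2 ^ l`; the nodes with even `q` carry the value zero. -/
abbrev TreeNode (T : ℕ) : Type := Fin (treeDepth T) × Fin (T + 1)

/-- The dyadic increments of `f`, as a vector indexed by the nodes of the tree. -/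
def treeVec (T : ℕ) (f : ℕ → ℝ) (p : TreeNode T) : ℝ := dyadicIncr f p.1 p.2

/-- For each level of the tree, the node of that level whose dyadic increment occurs in the binary
decomposition of the time step `i + 1`. -/
def treeNode (i : Fin T) : Fin (treeDepth T) ↪ TreeNode T where
  toFun l := (l, ⟨(i.val + 1) / 2 ^ l.val,
    Nat.lt_succ_of_le ((Nat.div_le_self _ _).trans i.isLt)⟩)
  inj' _ _ h := congrArg Prod.fst h

/-- The nodes of the tree that contribute to the output at time `i + 1`. -/
def treePath (i : Fin T) : Finset (TreeNode T) := Finset.univ.map (treeNode i)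

theorem card_treePath (i : Fin T) : (treePath i).card = treeDepth T := by
  rw [treePath, Finset.card_map, Finset.card_univ, Fintype.card_fin]

theorem treePath_nonempty (i : Fin T) : (treePath i).Nonempty :=
  Finset.card_pos.1 (card_treePath i ▸ treeDepth_pos T)

theorem sum_treeVec (f : ℕ → ℝ) (i : Fin T) :
    ∑ p ∈ treePath i, treeVec T f p = f (i.val + 1) - f 0 := by
  have hlt : i.val + 1 < 2 ^ treeDepth T :=
    lt_of_le_of_lt i.isLt (Nat.lt_pow_succ_log_self one_lt_two T)
  rw [treePath, Finset.sum_map, ← sum_dyadicIncr f hlt, Finset.sum_range]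
  rfl

theorem sum_abs_treeVec_sub_le {f g : ℕ → ℝ} {M : ℝ} (hM : 0 ≤ M)
    (h : eVariationOn (fun t => f t - g t) Set.univ ≤ ENNReal.ofReal M) :
    ∑ p, |treeVec T f p - treeVec T g p| ≤ treeDepth T * M := by
  have hsub : ∀ p : TreeNode T,
      treeVec T f p - treeVec T g p = dyadicIncr (fun t => f t - g t) p.1 p.2 := fun p =>
    sub_sub_sub_comm _ _ _ _
  calc ∑ p, |treeVec T f p - treeVec T g p|
      = ∑ l : Fin (treeDepth T), ∑ q ∈ Finset.range (T + 1),
          |dyadicIncr (fun t => f t - g t) l q| := by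
        simp_rw [hsub, Fintype.sum_prod_type, Finset.sum_range]
    _ ≤ ∑ _l : Fin (treeDepth T), M :=
        Finset.sum_le_sum fun l _ => sum_abs_dyadicIncr_le hM h l T
    _ = treeDepth T * M := by simp

end DyadicTree

section TreeRelease

variable {T : ℕ} {b K : ℝ}

/-- The joint law of the noise: independent Laplace noise of scale `b` at the nodes of the tree, and
an independent shift, common to all outputs, that is uniform on `[-K, K]`. The error allowed with
failure probability `δ` tends to zero as `δ → 1`; the shift bounds the density of the noise near
zero from below, as this requires. -/
noncomputable def treeNoise (T : ℕ) (b K : ℝ) : Measure ((TreeNode T → ℝ) × ℝ) :=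
  (Measure.pi fun _ => laplace b).prod (uniformSym K)

/-- The output of the tree mechanism for the sequence `f` and the noise `p`: the value at time
`i + 1` is perturbed by the noise of the nodes on its path and by the common shift. -/
def treeRelease (T : ℕ) (f : ℕ → ℝ) (p : (TreeNode T → ℝ) × ℝ) (i : Fin T) : ℝ :=
  f (i.val + 1) + (∑ n ∈ treePath i, p.1 n + p.2)

theorem isProbabilityMeasure_treeNoise (T : ℕ) (hb : 0 < b) (hK : 0 < K) :
    IsProbabilityMeasure (treeNoise T b K) := by
  have := isProbabilityMeasure_laplace hb
  have := isProbabilityMeasure_uniformSym hK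
  unfold treeNoise
  infer_instance

theorem measurable_treeRelease (T : ℕ) (f : ℕ → ℝ) : Measurable (treeRelease T f) := by
  unfold treeRelease
  fun_prop

-- The noise may be added to the dyadic increments instead of the values of `f`, so the release is
-- a post-processing of the Laplace mechanism applied to `treeVec T f`.
theorem treeRelease_eq_treeRelease_const (f : ℕ → ℝ) (p : (TreeNode T → ℝ) × ℝ) :
    treeRelease T f p = treeRelease T (fun _ => f 0) (treeVec T f + p.1, p.2) := by
  funext i
  simp only [treeRelease, Pi.add_apply, Finset.sum_add_distrib, sum_treeVec]
  ring

theorem map_treeRelease_treeNoise (f : ℕ → ℝ) (hb : 0 < b) (hK : 0 < K) :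
    (treeNoise T b K).map (treeRelease T f) =
      (((Measure.pi fun _ => laplace b).map (treeVec T f + ·)).prod (uniformSym K)).map
        (treeRelease T fun _ => f 0) := by
  have := isProbabilityMeasure_laplace hb
  have := isProbabilityMeasure_uniformSym hK
  have hadd : Measurable (treeVec T f + · : (TreeNode T → ℝ) → TreeNode T → ℝ) :=
    measurable_const_add _
  conv_rhs => rw [← Measure.map_id (μ := uniformSym K)]
  rw [Measure.map_prod_map _ _ hadd measurable_id,
    Measure.map_map (measurable_treeRelease T _) (hadd.prodMap measurable_id), treeNoise]
  exact congrArg (Measure.map · _) (funext (treeRelease_eq_treeRelease_const f))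

theorem map_treeRelease_le {f g : ℕ → ℝ} {M : ℝ} (hb : 0 < b) (hK : 0 < K) (hzero : f 0 = g 0)
    (hM : 0 ≤ M) (h : eVariationOn (fun t => f t - g t) Set.univ ≤ ENNReal.ofReal M)
    {O : Set (Fin T → ℝ)} (hO : MeasurableSet O) :
    (treeNoise T b K).map (treeRelease T f) O ≤
      ENNReal.ofReal (Real.exp (treeDepth T * M / b)) *
        (treeNoise T b K).map (treeRelease T g) O := by
  have := isProbabilityMeasure_uniformSym hK
  rw [map_treeRelease_treeNoise f hb hK, map_treeRelease_treeNoise g hb hK, ← hzero]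
  refine (map_prod_apply_le_of_le_smul (map_add_pi_laplace_le hb (treeVec T f) (treeVec T g)) _
    (measurable_treeRelease T _) hO).trans ?_
  gcongr
  exact sum_abs_treeVec_sub_le hM h

theorem le_map_treeRelease_abs_sub_le (f : ℕ → ℝ) (hb : 0 < b) (i : Fin T) {δ : ℝ} (hδ : 0 < δ)
    (hδ' : δ ≤ 1) :
    ENNReal.ofReal (1 - δ) ≤
      (treeNoise T b (4 * laplaceTailScale b (treeDepth T))).map (treeRelease T f)
        {x | |x i - f (i.val + 1)| ≤
          21 * laplaceTailScale b (treeDepth T) * Real.log δ⁻¹} := by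
  have := isProbabilityMeasure_laplace hb
  have htail := pi_laplace_abs_sum_gt_le hb (treePath_nonempty i)
  rw [card_treePath] at htail
  rw [Measure.map_apply (measurable_treeRelease T f)
    (measurableSet_le (by fun_prop) measurable_const)]
  simpa only [treeNoise, Set.preimage_ofPred_eq, treeRelease, add_sub_cancel_left] using
    le_prod_uniformSym_abs_add_le (by fun_prop)
      (laplaceTailScale_pos hb (treeDepth_pos T).ne') htail hδ hδ'

end TreeRelease

namespace IncrementalSeq

variable {V : Type u} [DecidableEq V] {W T : ℕ} {S S' : IncrementalSeq V W T}

theorem AgreeUpTo.mst_eq {s t : ℕ} (h : S.AgreeUpTo t S') (hs : s ≤ t) :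
    S.mst s = S'.mst s := by
  obtain ⟨-, hinit, hins, hweight⟩ := h
  have hedges : S.edges s = S'.edges s := by
    ext f
    rw [InsertionData.mem_edges, InsertionData.mem_edges, hinit]
    refine or_congr_right (exists_congr fun j => and_congr_right fun hj => ?_)
    rw [(hins j (hj.trans_le hs)).2]
  rw [mst, mst, ← hedges]
  exact mstWeight_congr fun f hf => hweight f (S.edges_mono hs hf)

theorem EdgeAdj.mst_zero_eq (h : S.EdgeAdj S') : S.mst 0 = S'.mst 0 := by
  obtain ⟨e, i, h⟩ := h.exists_insertsAlso
  rw [h.mst_right, mst, h.edges_of_le 0 (Nat.zero_le _)]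

theorem EdgeAdj.eVariationOn_mst_sub_le (h : S.EdgeAdj S') :
    eVariationOn (fun t => (S.mst t : ℝ) - S'.mst t) Set.univ ≤ ENNReal.ofReal (4 * W) :=
  let ⟨_, _, h⟩ := h.exists_insertsAlso
  h.eVariationOn_mst_sub_le

theorem EdgeAdj.eVariationOn_mst_sub_le' (h : S'.EdgeAdj S) :
    eVariationOn (fun t => (S.mst t : ℝ) - S'.mst t) Set.univ ≤ ENNReal.ofReal (4 * W) := by
  rw [← eVariationOn_neg]
  simpa only [Pi.neg_def, neg_sub] using h.eVariationOn_mst_sub_le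

end IncrementalSeq

section TreeMechanism

/-- The tree mechanism for the minimum spanning tree weight, with Laplace noise of scale `b` at the
nodes of the tree and a common shift that is uniform on `[-K, K]`. -/
noncomputable def treeMechanism (V : Type u) [DecidableEq V] (W T : ℕ) {b K : ℝ} (hb : 0 < b)
    (hK : 0 < K) : ContinualMechanism V W T where
  law S := (treeNoise T b K).map (treeRelease T fun t => S.mst t)
  isProbabilityMeasure S :=
    have := isProbabilityMeasure_treeNoise T hb hK
    Measure.isProbabilityMeasure_map (measurable_treeRelease T _).aemeasurable
  causal t S S' h := by
    have hrestrict : Measurable fun (x : Fin T → ℝ) (i : {i : Fin T // i.val < t}) => x i := by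
      fun_prop
    rw [Measure.map_map hrestrict (measurable_treeRelease T _),
      Measure.map_map hrestrict (measurable_treeRelease T _)]
    congr 1
    ext p i
    simp only [Function.comp, treeRelease]
    rw [h.mst_eq i.2]

variable (V : Type u) [DecidableEq V] {W T : ℕ} {b K ε : ℝ}

theorem edgeDP_treeMechanism (hb : 0 < b) (hK : 0 < K) (hε : treeDepth T * (4 * W) / b ≤ ε) :
    (treeMechanism V W T hb hK).EdgeDP ε := by
  intro S S' h O hO
  have hzero : (S.mst 0 : ℝ) = S'.mst 0 :=
    congrArg _ (h.elim (·.mst_zero_eq) (·.mst_zero_eq.symm))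
  have hvar : eVariationOn (fun t => (S.mst t : ℝ) - S'.mst t) Set.univ ≤ ENNReal.ofReal (4 * W) :=
    h.elim (·.eVariationOn_mst_sub_le) (·.eVariationOn_mst_sub_le')
  exact (map_treeRelease_le hb hK hzero (by positivity) hvar hO).trans
    (mul_le_mul' (ENNReal.ofReal_le_ofReal (Real.exp_le_exp.2 hε)) le_rfl)

theorem exists_edgeDP_mechanism (hW : 1 ≤ W) (hT : 2 ≤ T) (hε : 0 < ε) :
    ∃ A : ContinualMechanism V W T, A.EdgeDP ε ∧
      ∀ (S : IncrementalSeq V W T) (i : Fin T) (δ : ℝ), 0 < δ → δ < 1 →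
        ENNReal.ofReal (1 - δ) ≤
          A.law S {x | |x i - (S.mst (i.val + 1) : ℝ)| ≤
            1008 * (W * ε⁻¹ * Real.log T ^ (3 / 2 : ℝ) * Real.log δ⁻¹)} := by
  have hdepth := treeDepth_pos T
  set b : ℝ := treeDepth T * (4 * W) / ε with hb_def
  have hb : 0 < b := by positivity
  set σ := laplaceTailScale b (treeDepth T) with hσ_def
  have hσ : 0 < 4 * σ := mul_pos four_pos (laplaceTailScale_pos hb hdepth.ne')
  have hσ_le : σ ≤ 48 * (W * ε⁻¹ * Real.log T ^ (3 / 2 : ℝ)) :=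
    calc σ = 8 * W * ε⁻¹ * (treeDepth T * √(treeDepth T)) := by
          rw [hσ_def, laplaceTailScale, hb_def, div_eq_mul_inv]
          ring
      _ ≤ 8 * W * ε⁻¹ * (6 * Real.log T ^ (3 / 2 : ℝ)) :=
          mul_le_mul_of_nonneg_left (treeDepth_mul_sqrt_le hT) (by positivity)
      _ = _ := by ring
  refine ⟨treeMechanism V W T hb hσ, edgeDP_treeMechanism V hb hσ ?_, fun S i δ hδ hδ' => ?_⟩
  · rw [hb_def]
    exact (by field_simp : _ = ε).le
  · refine (le_map_treeRelease_abs_sub_le _ hb i hδ hδ'.le).trans (measure_mono ?_)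
    refine Set.ofPred_subset_ofPred.2 fun x hx => hx.trans ?_
    have hlog : 0 ≤ Real.log δ⁻¹ := Real.log_nonneg ((one_le_inv₀ hδ).2 hδ'.le)
    linarith [mul_le_mul_of_nonneg_right hσ_le hlog]

end TreeMechanism

theorem mainTheorem4_general :
    (∃ C : ℝ, 0 < C ∧
      ∀ (V : Type u) [DecidableEq V] (W T : ℕ) (ε : ℝ), 1 ≤ W → 2 ≤ T → 0 < ε →
        ∃ A : ContinualMechanism V W T, A.EdgeDP ε ∧
          ∀ (S : IncrementalSeq V W T) (i : Fin T) (δ : ℝ), 0 < δ → δ < 1 →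
            ENNReal.ofReal (1 - δ) ≤
              A.law S {x | |x i - (S.mst (i.val + 1) : ℝ)| ≤
                C * (W * ε⁻¹ * Real.log T ^ (3 / 2 : ℝ) * Real.log δ⁻¹)}) ∧
    (∀ (V : Type u) [DecidableEq V] (W T : ℕ),
      2 * (W : ℝ) - 2 ∈ upperBounds (diffMstDistances V W T) ∧
        (Nonempty (Fin 4 ↪ V) → 1 ≤ W → 2 ≤ T →
          IsGreatest (diffMstDistances V W T) (2 * (W : ℝ) - 2))) :=
  ⟨⟨1008, by norm_num, fun V _ _ _ _ hW hT hε => exists_edgeDP_mechanism V hW hT hε⟩,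
    fun V _ W T =>
      have hub := IncrementalSeq.two_mul_sub_two_mem_upperBounds V W T
      ⟨hub, fun ⟨g⟩ hW hT =>
        ⟨IncrementalSeq.two_mul_sub_two_mem_diffMstDistances g hW hT, hub⟩⟩⟩

theorem mainTheorem4 :
    (∃ C : ℝ, 0 < C ∧
      ∀ (V : Type u) [DecidableEq V] (W T : ℕ) (ε : ℝ), 1 ≤ W → 2 ≤ T → 0 < ε →
        ∃ A : ContinualMechanism V W T, A.EdgeDP ε ∧
          ∀ (S : IncrementalSeq V W T) (i : Fin T) (δ : ℝ), 0 < δ → δ < 1 →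
            ENNReal.ofReal (1 - δ) ≤
              A.law S {x | |x i - (S.mst (i.val + 1) : ℝ)| ≤
                C * (W * ε⁻¹ * Real.log T ^ (3 / 2 : ℝ) * Real.log δ⁻¹)}) ∧
    (∀ (V : Type u) [DecidableEq V] [Infinite V] (W : ℕ), 1 ≤ W → ∀ T : ℕ,
      2 * (W : ℝ) - 2 ∈ upperBounds (diffMstDistances V W T) ∧
        (2 ≤ T → IsGreatest (diffMstDistances V W T) (2 * (W : ℝ) - 2))) :=
  ⟨mainTheorem4_general.1, fun V _ _ W hW T =>
    (mainTheorem4_general.2 V W T).imp_right fun h =>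
      h ⟨Fin.valEmbedding.trans (Infinite.natEmbedding V)⟩ hW⟩
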